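/- Let $D=(-1,1)$, let $\varrho$ be the uniform probability measure on $D$, i.e. $d\varrho(x)=\tfrac12\,dx$, and let $\mathbb P_{n-1}$ be the space of complex algebraic polynomials of degree less than $n$. Let $c:D\to(0,\infty)$ be a (measurable) cost function. Let $r>1$, let $n\in\mathbb N$ satisfy $n\ge \log(r)/\log(1+\sqrt8)$, let $$0\le\sigma\le (r^{1/n}-1)^2/16,\qquad \Omega=(-(1-\sigma),1-\sigma),$$ and let $0<\epsilon<1$. Let $\mu$ be a probability measure on $D$ that is absolutely continuous with respect to $\varrho$, with density $v=d\mu/d\varrho$ that is positive almost everywhere in $\Omega$, and put $w=1/v:D\to[0,\infty]$. For $x\in\Omega$ let $$\mathcal K(x)=\sup\{|p(x)|^2 : p\in\mathbb P_{n-1},\ \|p\|_{L^2_\varrho(\Omega)}=1\}.$$ Then there is a number of samples $m\ge n$ such that the expected cost of i.i.d. samples $x_1,\dots,x_m\sim\mu$ satisfies $$C_{\mathsf{exp}}:=\mathbb E\big(c(x_1)+\cdots+c(x_m)\big)\le 8\int_{\mathrm{supp}(\mu)}\frac{c(x)}{w(x)}\,dx\cdot\sup_{|x|<1-\sigma}\{w(x)\,\mathcal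 K(x)\}\cdot\log(3n/\epsilon)$$ (both sides in $[0,\infty]$), and such that, for every $f\in L^2_\varrho(D)$, with probability at least $1-\epsilon$ over $x_1,\dots,x_m\sim_{\mathrm{i.i.d.}}\mu$, the following holds. For every $e\in\mathbb C^m$, with $y_i=f(x_i)+e_i$, the weighted least-squares problem $$\min_{p\in\mathbb P_{n-1}}\frac1m\sum_{i=1}^m w(x_i)\,|y_i-p(x_i)|^2$$ has a minimizer, and every minimizer $\hat f$ satisfies $$\|f-\hat f\|_{L^2_\varrho(D)}\le\|f-f_n\|_{L^2_\varrho(D)}+\frac{8rn}{\sqrt\epsilon}\big(\|f-f_n\|_{L^2_\varrho(D)}+\|e\|_2\big),$$ $$\|f-\hat f\|_{L^\infty_\varrho(D)}\le\|f-f_n\|_{L^\infty_\varrho(D)}+\frac{8rn}{\sqrt\epsilon}\big(\|f-f_n\|_{L^2_\varrho(D)}+\|e\|_2\big),$$ where $f_n$ is the best approximation of $f$ from $\mathbb P_{n-1}$ in the $L^2_\varrho(D)$-norm (and $\|f-f_n\|_{L^\infty_\varrho(D)}$ may be $\infty$). -/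

import Mathlib

open MeasureTheory Set
open scoped ENNReal

noncomputable section

namespace CostSampling

/-- The uniform probability measure `dϱ = dx / 2` on `D = (-1, 1)`, as a measure on `ℝ`. -/
def unif : Measure ℝ := (2⁻¹ : ℝ≥0∞) • volume.restrict (Ioo (-1 : ℝ) 1)

/-- A complex polynomial, as a function of a real variable. -/
def polyFun : Polynomial ℂ →ₗ[ℂ] (ℝ → ℂ) where
  toFun p := fun x => p.eval (x : ℂ)
  map_add' p q := by ext x; simp
  map_smul' a p := by ext x; simp

/-- The space `ℙ_{n-1}` of algebraic polynomials of degree less than `n`. -/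
def polySpace (n : ℕ) : Submodule ℂ (ℝ → ℂ) := (Polynomial.degreeLT ℂ n).map polyFun

/-- The weight function `w = 1 / v`, with values in `[0, ∞]` (`w = ∞` where `v = 0`). -/
def weight (v : ℝ → ℝ≥0∞) (x : ℝ) : ℝ≥0∞ := (v x)⁻¹

/-- The (reciprocal) Christoffel function
`K(P, L²_ν)(x) = sup { |p(x)|² : p ∈ P, ‖p‖²_{L²_ν} = 1 }`. -/
def christoffel (P : Submodule ℂ (ℝ → ℂ)) (ν : Measure ℝ) (x : ℝ) : ℝ≥0∞ :=
  ⨆ p ∈ {p | p ∈ P ∧ eLpNorm p 2 ν ^ 2 = 1}, ‖p x‖ₑ ^ 2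

/-- `g ∈ P` is a best approximation of `f` from `P` in the `L²_ν`-norm. -/
def IsBestApprox (P : Submodule ℂ (ℝ → ℂ)) (ν : Measure ℝ) (f g : ℝ → ℂ) : Prop :=
  g ∈ P ∧ IsMinOn (fun p : ℝ → ℂ => eLpNorm (f - p) 2 ν) (P : Set (ℝ → ℂ)) g

/-- The weighted least-squares objective `(1/m) ∑ i, w(x_i) |y_i - p(x_i)|²`. -/
def wlsObjective {m : ℕ} (w : ℝ → ℝ≥0∞) (x : Fin m → ℝ) (y : Fin m → ℂ) (p : ℝ → ℂ) : ℝ≥0∞ :=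
  (m : ℝ≥0∞)⁻¹ * ∑ i, w (x i) * ‖y i - p (x i)‖ₑ ^ 2

/-- `g ∈ P` is a minimizer of the weighted least-squares problem over `P`,
that is, a weighted least-squares estimator for the data `(x_i, y_i)`. -/
def IsWLSMinimizer {m : ℕ} (P : Submodule ℂ (ℝ → ℂ)) (w : ℝ → ℝ≥0∞)
    (x : Fin m → ℝ) (y : Fin m → ℂ) (g : ℝ → ℂ) : Prop :=
  g ∈ P ∧ IsMinOn (wlsObjective w x y) (P : Set (ℝ → ℂ)) g

/-- The law of `m` i.i.d. sample points drawn from `μ`. -/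
def sampleLaw (m : ℕ) (μ : Measure ℝ) : Measure (Fin m → ℝ) := Measure.pi fun _ => μ

/-- The expected cost `𝔼(c(x_1) + ⋯ + c(x_m))` of `m` i.i.d. samples from `μ`
(equal to `∞` if `c ≥ 0` is not integrable). -/
def expectedCost (m : ℕ) (μ : Measure ℝ) (c : ℝ → ℝ) : ℝ≥0∞ :=
  ∫⁻ x, ∑ i, ENNReal.ofReal (c (x i)) ∂(sampleLaw m μ)

end CostSampling

end

/-! Put `s = 1 - σ`, `ρ = r^(1/n)`, and let `L_k` be the Legendre polynomials rescaled to be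
orthonormal on `Ω = (-s, s)`. Two facts about `∑ L_k²` carry the theorem.

Growth: the choice of `σ` makes `1/s ≤ (ρ + 1/ρ)/2`, and at such arguments the k-th Legendre
polynomial is at most `ρ^k`. Hence `∑ L_k² ≤ 2(nr)²` on all of `[-1, 1]` (`sum_orthoPoly_sq_le`),
and a bound on coefficients over `Ω` becomes a uniform bound on `D`.

Stability: let `κ = sup w·K`. The vectors `√w(x_i) (L_k(x_i))_k`, set to zero outside `Ω`, have
squared norm at most `κ` and mean outer product the identity. A matrix Chernoff bound shows that
with `m = ⌊16 κ log(3n/ε)⌋` samples the smallest eigenvalue of their Gram sum exceeds `m/2`, except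
with probability `ε/3`. If `κ = ∞` the cost bound only asks for some `m`, and the vectors are
truncated to a set where `w·K` is bounded.

Markov's inequality gives `∑ w(x_i)|f - f_n|² ≤ (3m/ε)‖f - f_n‖²` and `∑ w(x_i) ≤ 3m/ε`, each
failing with probability at most `ε/3`. On the good event, comparing a minimizer with `f_n` bounds
the coefficients of their difference (`exists_recovery_event`). Since `𝔼 c(x_1) = ½∫ c/w`, the cost
constant is `16/2 = 8`.

The Chernoff bound (`measure_exists_sum_sq_lt_le`) avoids matrix exponentials. It follows the trace
of a high power of `ZZᵀ`, where `Z` is a product of factors `1 - δuuᵀ`. A Lieb–Thirring inequality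
for exponents `2^k` makes each sample shrink the expected trace by a fixed factor, and letting the
exponent tend to infinity recovers the exponential moment bound. -/

namespace CostSampling

/-! ### Trace inequalities of Lieb–Thirring type from Cauchy–Schwarz. -/

section TraceInequalities

open Matrix

variable {N : ℕ}

local notation "Mat" => Matrix (Fin N) (Fin N) ℝ

theorem trace_mul_transpose_eq_sum (A : Mat) : (A * Aᵀ).trace = ∑ i, ∑ j, A i j ^ 2 := by
  simp [Matrix.trace, Matrix.mul_apply, sq]

theorem trace_mul_sq_le (A B : Mat) :
    (A * B).trace ^ 2 ≤ (A * Aᵀ).trace * (Bᵀ * B).trace := by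
  have h := Finset.sum_mul_sq_le_sq_mul_sq (Finset.univ : Finset (Fin N × Fin N))
    (fun p => A p.1 p.2) (fun p => B p.2 p.1)
  have h3 : (Bᵀ * B).trace = ∑ i, ∑ j, B j i ^ 2 := by
    simpa using trace_mul_transpose_eq_sum Bᵀ
  rw [trace_mul_transpose_eq_sum, h3]
  simp only [Fintype.sum_prod_type] at h
  simpa [Matrix.trace, Matrix.mul_apply] using h

theorem trace_pow_mul_comm (A B : Mat) (k : ℕ) : ((A * B) ^ k).trace = ((B * A) ^ k).trace := by
  rcases k with _ | k
  · simp
  · have h : ∀ j : ℕ, (A * B) ^ j * A = A * (B * A) ^ j := by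
      intro j
      induction j with
      | zero => simp
      | succ j ih =>
        rw [pow_succ', mul_assoc, ih, pow_succ']
        simp only [mul_assoc]
    rw [pow_succ, ← mul_assoc, h, Matrix.trace_mul_comm, ← mul_assoc, ← pow_succ']

/-- The two claims feed each other. The first at `k`, for `Y = PQ`, produces `QP²Q`; cycling turns
this into `P²Q²`, to which the second at `k` applies. The first at `k`, for `Y²`, cycles to
`(YᵀY)(YYᵀ)`; the second at `k` splits the power, and Cauchy–Schwarz finishes because `YᵀY` and
`YYᵀ` have equal traces of powers. -/
theorem abs_trace_pow_two_pow_le (k : ℕ) :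
    (∀ Y : Mat, |(Y ^ (2 ^ (k + 1))).trace| ≤ ((Yᵀ * Y) ^ (2 ^ k)).trace) ∧
    ∀ P Q : Mat, Pᵀ = P → Qᵀ = Q →
      |((P * Q) ^ (2 ^ k)).trace| ≤ |(P ^ (2 ^ k) * Q ^ (2 ^ k)).trace| := by
  induction k with
  | zero =>
    refine ⟨fun Y => ?_, fun P Q _ _ => by simp⟩
    have h := trace_mul_sq_le Y Y
    rw [Matrix.trace_mul_comm Y Yᵀ] at h
    have h0 : 0 ≤ (Yᵀ * Y).trace := by
      have := trace_mul_transpose_eq_sum Yᵀ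
      rw [transpose_transpose] at this
      rw [this]; positivity
    simpa [pow_two] using abs_le_of_sq_le_sq (h.trans_eq (sq _).symm) h0
  | succ k ih =>
    obtain ⟨ih1, ih2⟩ := ih
    have key : ∀ P Q : Mat, Pᵀ = P → Qᵀ = Q →
        |((P * Q) ^ (2 ^ (k + 1))).trace| ≤ |(P ^ (2 ^ (k + 1)) * Q ^ (2 ^ (k + 1))).trace| := by
      intro P Q hP hQ
      refine (ih1 (P * Q)).trans ?_
      have h1 : (P * Q)ᵀ * (P * Q) = Q * (P ^ 2 * Q) := by
        rw [transpose_mul, hP, hQ, sq]; simp only [mul_assoc]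
      rw [h1, trace_pow_mul_comm, mul_assoc, ← sq]
      refine (le_abs_self _).trans ((ih2 (P ^ 2) (Q ^ 2) ?_ ?_).trans (le_of_eq ?_))
      · rw [transpose_pow, hP]
      · rw [transpose_pow, hQ]
      · rw [← pow_mul, ← pow_mul, pow_succ' 2 k]
    refine ⟨fun Y => ?_, key⟩
    have e : Y ^ (2 ^ (k + 1 + 1)) = (Y ^ 2) ^ (2 ^ (k + 1)) := by
      rw [← pow_mul, ← pow_succ']
    rw [e]
    refine (ih1 (Y ^ 2)).trans ?_
    have h1 : (Y ^ 2)ᵀ * Y ^ 2 = Yᵀ * ((Yᵀ * Y) * Y) := by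
      rw [transpose_pow, sq, sq]; simp only [mul_assoc]
    rw [h1, trace_pow_mul_comm, mul_assoc]
    have hP : (Yᵀ * Y)ᵀ = Yᵀ * Y := by simp
    have hQ : (Y * Yᵀ)ᵀ = Y * Yᵀ := by simp
    refine (le_abs_self _).trans ((ih2 (Yᵀ * Y) (Y * Yᵀ) hP hQ).trans ?_)
    have h2 := trace_mul_sq_le ((Yᵀ * Y) ^ 2 ^ k) ((Y * Yᵀ) ^ 2 ^ k)
    rw [transpose_pow, transpose_pow, hP, hQ, ← pow_add, ← pow_add, ← two_mul, ← pow_succ',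
      trace_pow_mul_comm Y Yᵀ, ← sq] at h2
    refine abs_le_of_sq_le_sq h2 ?_
    rw [pow_succ, pow_mul, sq]
    have h3 := trace_mul_transpose_eq_sum ((Yᵀ * Y) ^ 2 ^ k)
    rw [transpose_pow, hP] at h3
    rw [h3]; positivity

/-- A Lieb–Thirring type trace inequality for exponents that are powers of two. -/
theorem trace_conj_pow_le (k : ℕ) (D B : Mat) (hD : Dᵀ = D) (hB : Bᵀ = B) :
    ((D * B * D) ^ (2 ^ k)).trace ≤ |(B ^ (2 ^ k) * D ^ (2 * 2 ^ k)).trace| := by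
  rw [mul_assoc, trace_pow_mul_comm, mul_assoc, ← sq, pow_mul]
  exact (le_abs_self _).trans ((abs_trace_pow_two_pow_le k).2 B (D ^ 2) hB
    (by rw [transpose_pow, hD]))

/-- Repeated Cauchy–Schwarz moves the power inside the quadratic form. The last square is `‖Ca‖²`
with `C = B^(2^k)`, bounded by the Frobenius norm of `C`. This replaces an appeal to the spectral
theorem. -/
theorem dotProduct_mulVec_pow_two_pow_le (B : Mat) (hB : Bᵀ = B) (a : Fin N → ℝ)
    (ha : a ⬝ᵥ a = 1) (k : ℕ) :
    (a ⬝ᵥ (B *ᵥ a)) ^ (2 ^ (k + 1)) ≤ (B ^ (2 ^ (k + 1))).trace := by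
  have cs : ∀ b : Fin N → ℝ, (a ⬝ᵥ b) ^ 2 ≤ b ⬝ᵥ b := by
    intro b
    have h := Finset.sum_mul_sq_le_sq_mul_sq Finset.univ a b
    have h1 : ∑ i, a i ^ 2 = 1 := by simpa [dotProduct, sq] using ha
    rw [h1, one_mul] at h
    simpa [dotProduct, sq] using h
  have sym : ∀ j : ℕ, (B ^ j *ᵥ a) ⬝ᵥ (B ^ j *ᵥ a) = a ⬝ᵥ (B ^ (j + j) *ᵥ a) := by
    intro j
    rw [pow_add, ← mulVec_mulVec, dotProduct_mulVec a, ← mulVec_transpose, transpose_pow, hB]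
  have h1 : ∀ k : ℕ, (a ⬝ᵥ (B *ᵥ a)) ^ (2 ^ (k + 1)) ≤ a ⬝ᵥ (B ^ (2 ^ (k + 1)) *ᵥ a) := by
    intro k
    induction k with
    | zero =>
      have := (cs (B ^ 1 *ᵥ a)).trans_eq (sym 1)
      simpa using this
    | succ k ih =>
      have e : 2 ^ (k + 1 + 1) = 2 ^ (k + 1) * 2 := pow_succ _ _
      calc _ = ((a ⬝ᵥ (B *ᵥ a)) ^ (2 ^ (k + 1))) ^ 2 := by rw [e, pow_mul]
        _ ≤ (a ⬝ᵥ (B ^ (2 ^ (k + 1)) *ᵥ a)) ^ 2 := by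
            gcongr
            rw [pow_succ, pow_mul]; positivity
        _ ≤ _ := cs _
        _ = _ := by rw [sym, ← two_mul, ← pow_succ']
  refine (h1 k).trans ?_
  have e : 2 ^ (k + 1) = 2 ^ k + 2 ^ k := by rw [pow_succ]; ring
  rw [e, ← sym]
  set C := B ^ 2 ^ k with hC
  have hCt : Cᵀ = C := by rw [hC, transpose_pow, hB]
  have h3 := trace_mul_transpose_eq_sum C
  rw [hCt] at h3
  rw [pow_add, h3]
  simp only [dotProduct]
  refine Finset.sum_le_sum fun i _ => ?_
  have h := Finset.sum_mul_sq_le_sq_mul_sq Finset.univ (C i) a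
  have h1 : ∑ i, a i ^ 2 = 1 := by simpa [dotProduct, sq] using ha
  rw [h1, mul_one] at h
  simpa [mulVec, dotProduct, sq] using h

end TraceInequalities

/-! ### Deterministic part of the Chernoff bound: products of rank-one contractions. -/

section MatrixChernoff

open Matrix

variable {N : ℕ}

local notation "Mat" => Matrix (Fin N) (Fin N) ℝ

/-- The contraction `1 - δ u uᵀ`. -/
noncomputable def rankOneContraction (δ : ℝ) (u : Fin N → ℝ) : Mat := 1 - δ • vecMulVec u u

theorem transpose_rankOneContraction (δ : ℝ) (u : Fin N → ℝ) :
    (rankOneContraction δ u)ᵀ = rankOneContraction δ u := by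
  simp [rankOneContraction, transpose_vecMulVec]

/-- `uuᵀ` is idempotent up to the scalar `u ⬝ᵥ u`, so powers stay in the span of `1` and `uuᵀ` and
the coefficient is a geometric sum. -/
theorem rankOneContraction_pow (δ : ℝ) (u : Fin N → ℝ) (j : ℕ) :
    rankOneContraction δ u ^ j =
      1 - (∑ i ∈ Finset.range j, δ * (1 - δ * (u ⬝ᵥ u)) ^ i) • vecMulVec u u := by
  induction j with
  | zero => simp
  | succ j ih =>
    have hg : δ * (u ⬝ᵥ u) * ∑ i ∈ Finset.range j, (1 - δ * (u ⬝ᵥ u)) ^ i =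
        1 - (1 - δ * (u ⬝ᵥ u)) ^ j := by
      have := geom_sum_mul_neg (1 - δ * (u ⬝ᵥ u)) j
      linear_combination this
    have hs : δ * (1 - δ * (u ⬝ᵥ u)) ^ j = δ - δ * (u ⬝ᵥ u) *
        ∑ i ∈ Finset.range j, δ * (1 - δ * (u ⬝ᵥ u)) ^ i := by
      rw [← Finset.mul_sum]
      linear_combination δ * hg
    rw [pow_succ, ih, Finset.sum_range_succ, hs]
    generalize ∑ i ∈ Finset.range j, δ * (1 - δ * (u ⬝ᵥ u)) ^ i = c
    have hv : vecMulVec u u * vecMulVec u u = (u ⬝ᵥ u) • vecMulVec u u := by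
      rw [vecMulVec_mul_vecMulVec]
      ext i j; simp [vecMulVec_apply]; ring
    rw [rankOneContraction, mul_sub, mul_one, sub_mul, one_mul, smul_mul_smul_comm, hv]
    module

/-- The sum decreases in `t`, so `t = κ` is the worst case; there it equals `(1 - (1 - δκ)^j)/κ`,
and `jδκ = log 2` makes `(1 - δκ)^j ≤ 1/2`. -/
theorem le_sum_geometric {κ δ t : ℝ} (hκ : 0 < κ) (hδ : 0 ≤ δ) (ht : t ≤ κ)
    (hδκ : δ * κ ≤ 1) (j : ℕ) (hj : j * (δ * κ) = Real.log 2) :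
    1 / (2 * κ) ≤ ∑ i ∈ Finset.range j, δ * (1 - δ * t) ^ i := by
  have h1 : ∑ i ∈ Finset.range j, δ * (1 - δ * κ) ^ i ≤
      ∑ i ∈ Finset.range j, δ * (1 - δ * t) ^ i := by
    gcongr
  refine le_trans ?_ h1
  have hg : κ * ∑ i ∈ Finset.range j, δ * (1 - δ * κ) ^ i = 1 - (1 - δ * κ) ^ j := by
    rw [← Finset.mul_sum]
    linear_combination geom_sum_mul_neg (1 - δ * κ) j
  have h2 : (1 - δ * κ) ^ j ≤ 1 / 2 := by
    calc (1 - δ * κ) ^ j ≤ (Real.exp (-(δ * κ))) ^ j := by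
          gcongr
          exact Real.one_sub_le_exp_neg _
      _ = 1 / 2 := by
          rw [← Real.exp_nat_mul, mul_neg, hj, Real.exp_neg, Real.exp_log two_pos]; norm_num
  rw [div_le_iff₀ (by positivity)]
  nlinarith

theorem trace_pow_two_pow_eq_sum (B : Mat) (hB : Bᵀ = B) (k : ℕ) :
    (B ^ (2 ^ (k + 1))).trace = ∑ i, ∑ j, (B ^ 2 ^ k) i j ^ 2 := by
  rw [← trace_mul_transpose_eq_sum, transpose_pow, hB, ← pow_add, pow_succ, mul_two]

/-- One step of the trace recursion. -/
theorem trace_conj_rankOneContraction_pow_le {κ δ : ℝ} (hκ : 0 < κ) (hδ : 0 ≤ δ)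
    (hδκ : δ * κ ≤ 1) (k : ℕ) (hk : (2 * 2 ^ (k + 1) : ℕ) * (δ * κ) = Real.log 2)
    (u : Fin N → ℝ) (hu : u ⬝ᵥ u ≤ κ) (B : Mat) (hB : Bᵀ = B) :
    ((rankOneContraction δ u * B * rankOneContraction δ u) ^ (2 ^ (k + 1))).trace ≤
      (B ^ (2 ^ (k + 1))).trace - 1 / (2 * κ) * ∑ i, ((B ^ 2 ^ k) i ⬝ᵥ u) ^ 2 := by
  set D := rankOneContraction δ u with hD
  have hDt : Dᵀ = D := transpose_rankOneContraction δ u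
  refine (trace_conj_pow_le (k + 1) D B hDt hB).trans ?_
  have hnn : 0 ≤ (B ^ 2 ^ (k + 1) * D ^ (2 * 2 ^ (k + 1))).trace := by
    have h := trace_mul_transpose_eq_sum (B ^ 2 ^ k * D ^ 2 ^ (k + 1))
    rw [transpose_mul, transpose_pow, transpose_pow, hDt, hB, ← mul_assoc, mul_assoc (B ^ _),
      ← pow_add, Matrix.trace_mul_comm, ← mul_assoc, ← pow_add, ← two_mul, ← two_mul,
      ← pow_succ'] at h
    rw [h]; positivity
  rw [abs_of_nonneg hnn, hD, rankOneContraction_pow, mul_sub, mul_one, trace_sub, mul_smul_comm,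
    trace_smul, smul_eq_mul]
  have ht : (B ^ 2 ^ (k + 1) * vecMulVec u u).trace = ∑ i, ((B ^ 2 ^ k) i ⬝ᵥ u) ^ 2 := by
    rw [mul_vecMulVec, trace_vecMulVec, pow_succ 2 k, mul_two, pow_add, ← mulVec_mulVec,
      dotProduct_comm, dotProduct_mulVec, ← mulVec_transpose, transpose_pow, hB]
    simp [dotProduct, mulVec, sq]
  rw [ht]
  gcongr
  exact le_sum_geometric hκ hδ hu hδκ _ hk

variable {α : Type*}

/-- The ordered product of the contractions `1 - δ u(x_i) u(x_i)ᵀ`. -/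
noncomputable def contractionProd (δ : ℝ) (u : α → Fin N → ℝ) : (m : ℕ) → (Fin m → α) → Mat
  | 0, _ => 1
  | m + 1, x => rankOneContraction δ (u (x 0)) * contractionProd δ u m (Fin.tail x)

theorem rankOneContraction_mulVec (δ : ℝ) (u z : Fin N → ℝ) :
    rankOneContraction δ u *ᵥ z = z - (δ * (u ⬝ᵥ z)) • u := by
  rw [rankOneContraction, sub_mulVec, one_mulVec, smul_mulVec, vecMulVec_mulVec]
  ext i
  simp; ring

theorem dotProduct_sq_le (a b : Fin N → ℝ) : (a ⬝ᵥ b) ^ 2 ≤ (a ⬝ᵥ a) * (b ⬝ᵥ b) := by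
  simpa [dotProduct, sq] using Finset.sum_mul_sq_le_sq_mul_sq Finset.univ a b

/-- To first order in `δ` the product is `1 - δ∑ u_i u_iᵀ`; the third bound makes this quantitative
and the other two serve its induction. A new factor adds an error `δ(u·a)(u·(z - a)) ≤ m(δκ)²`, and
`m² + m ≤ (m+1)²`. Being quadratic in `δ`, this error disappears when `δ` is of order `1/p` and the
p-th power is taken. -/
theorem contractionProd_mulVec_bounds {κ δ : ℝ} (hκ : 0 < κ) (hδ : 0 ≤ δ) (hδκ : δ * κ ≤ 1)
    (u : α → Fin N → ℝ) (hu : ∀ x, u x ⬝ᵥ u x ≤ κ) (a : Fin N → ℝ) (ha : a ⬝ᵥ a = 1)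
    (m : ℕ) (x : Fin m → α) :
    (contractionProd δ u m x *ᵥ a) ⬝ᵥ (contractionProd δ u m x *ᵥ a) ≤ 1 ∧
    (∀ b : Fin N → ℝ, b ⬝ᵥ b ≤ κ →
      |b ⬝ᵥ (contractionProd δ u m x *ᵥ a - a)| ≤ m * (δ * κ) * √κ) ∧
    1 - δ * ∑ i, (u (x i) ⬝ᵥ a) ^ 2 - (m * (δ * κ)) ^ 2 ≤
      a ⬝ᵥ (contractionProd δ u m x *ᵥ a) := by
  induction m with
  | zero => simp [contractionProd, ha]
  | succ m ih =>
    obtain ⟨h1, h2, h3⟩ := ih (Fin.tail x)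
    set z := contractionProd δ u m (Fin.tail x) *ᵥ a with hz
    have hz' : contractionProd δ u (m + 1) x *ᵥ a = z - (δ * (u (x 0) ⬝ᵥ z)) • u (x 0) := by
      rw [contractionProd, ← mulVec_mulVec, ← hz, rankOneContraction_mulVec]
    rw [hz']
    set w := u (x 0) with hw
    have hwκ : w ⬝ᵥ w ≤ κ := hu _
    have hww : 0 ≤ w ⬝ᵥ w := by simp only [dotProduct]; exact Finset.sum_nonneg fun i _ => mul_self_nonneg _
    have hs : |w ⬝ᵥ z| ≤ √κ := by
      apply Real.abs_le_sqrt
      refine (dotProduct_sq_le w z).trans ?_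
      nlinarith
    have hκs : √κ * √κ = κ := Real.mul_self_sqrt hκ.le
    have hb : ∀ b : Fin N → ℝ, b ⬝ᵥ b ≤ κ → |b ⬝ᵥ w| ≤ κ := by
      intro b hb
      refine abs_le_of_sq_le_sq ((dotProduct_sq_le b w).trans ?_) hκ.le
      rw [sq]
      gcongr
    refine ⟨?_, ?_, ?_⟩
    · simp only [sub_dotProduct, dotProduct_sub, smul_dotProduct, dotProduct_smul, smul_eq_mul,
        dotProduct_comm z w]
      nlinarith [mul_nonneg hδ (sq_nonneg (w ⬝ᵥ z)),
        mul_nonneg (mul_nonneg hδ (sq_nonneg (w ⬝ᵥ z))) (mul_nonneg hδ (sub_nonneg.2 hwκ)),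
        mul_nonneg (mul_nonneg hδ (sq_nonneg (w ⬝ᵥ z))) (sub_nonneg.2 hδκ)]
    · intro b hbκ
      have e : b ⬝ᵥ (z - (δ * (w ⬝ᵥ z)) • w - a) = b ⬝ᵥ (z - a) - δ * (w ⬝ᵥ z) * (b ⬝ᵥ w) := by
        simp only [dotProduct_sub, dotProduct_smul, smul_eq_mul]; ring
      rw [e]
      refine (abs_sub _ _).trans ?_
      rw [abs_mul, abs_mul, abs_of_nonneg hδ]
      have := mul_le_mul hs (hb b hbκ) (abs_nonneg _) (Real.sqrt_nonneg _)
      have h4 := mul_le_mul_of_nonneg_left this hδ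
      have h5 := h2 b hbκ
      push_cast
      nlinarith
    · have e : a ⬝ᵥ (z - (δ * (w ⬝ᵥ z)) • w) =
          a ⬝ᵥ z - δ * (w ⬝ᵥ a) ^ 2 - δ * ((w ⬝ᵥ a) * (w ⬝ᵥ (z - a))) := by
        simp only [dotProduct_sub, dotProduct_smul, smul_eq_mul, dotProduct_comm a w]; ring
      rw [e, Fin.sum_univ_succ]
      have ha' : |w ⬝ᵥ a| ≤ √κ := by
        apply Real.abs_le_sqrt
        refine (dotProduct_sq_le w a).trans ?_
        rw [ha, mul_one]; exact hwκ
      have h5 := mul_le_mul ha' (h2 w hwκ) (abs_nonneg _) (Real.sqrt_nonneg _)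
      rw [← abs_mul] at h5
      have h6 := (le_abs_self _).trans h5
      have h7 := mul_le_mul_of_nonneg_left h6 hδ
      have h8 : √κ * (m * (δ * κ) * √κ) = m * (δ * κ) * κ := by
        rw [mul_comm, mul_assoc, hκs]
      rw [h8] at h7
      have h9 : 0 ≤ (m + 1) * (δ * κ) ^ 2 := by positivity
      have h3' : 1 - δ * ∑ i, (u (Fin.tail x i) ⬝ᵥ a) ^ 2 - (m * (δ * κ)) ^ 2 ≤ a ⬝ᵥ z := h3
      simp only [Fin.tail] at h3'
      push_cast
      nlinarith

theorem pow_le_trace_contractionProd {κ δ : ℝ} (hκ : 0 < κ) (hδ : 0 ≤ δ) (hδκ : δ * κ ≤ 1)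
    (u : α → Fin N → ℝ) (hu : ∀ x, u x ⬝ᵥ u x ≤ κ) (a : Fin N → ℝ) (ha : a ⬝ᵥ a = 1)
    (m : ℕ) (x : Fin m → α) (k : ℕ) {s : ℝ} (hs : ∑ i, (u (x i) ⬝ᵥ a) ^ 2 ≤ s)
    (hpos : 0 ≤ 1 - δ * s - (m * (δ * κ)) ^ 2) :
    (1 - δ * s - (m * (δ * κ)) ^ 2) ^ (2 * 2 ^ (k + 1)) ≤
      ((contractionProd δ u m x * (contractionProd δ u m x)ᵀ) ^ (2 ^ (k + 1))).trace := by
  set Z := contractionProd δ u m x with hZ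
  have h1 := (contractionProd_mulVec_bounds hκ hδ hδκ u hu a ha m x).2.2
  rw [← hZ] at h1
  refine le_trans ?_ (dotProduct_mulVec_pow_two_pow_le (Z * Zᵀ) (by simp) a ha k)
  rw [pow_mul]
  have h2 : a ⬝ᵥ ((Z * Zᵀ) *ᵥ a) = (Zᵀ *ᵥ a) ⬝ᵥ (Zᵀ *ᵥ a) := by
    rw [← mulVec_mulVec, dotProduct_mulVec, ← mulVec_transpose]
  have h3 : a ⬝ᵥ (Z *ᵥ a) = a ⬝ᵥ (Zᵀ *ᵥ a) := by
    rw [dotProduct_mulVec, ← mulVec_transpose, dotProduct_comm]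
  have h4 := dotProduct_sq_le a (Zᵀ *ᵥ a)
  rw [ha, one_mul, ← h3, ← h2] at h4
  gcongr
  refine le_trans ?_ h4
  gcongr
  refine le_trans ?_ h1
  gcongr

end MatrixChernoff

/-! ### The expected trace and the lower tail of the smallest eigenvalue. -/

section MatrixChernoffProbability

open Matrix

variable {N : ℕ}

local notation "Mat" => Matrix (Fin N) (Fin N) ℝ

theorem measurable_mul_apply {β : Type*} [MeasurableSpace β] {F G : β → Mat}
    (hF : ∀ i j, Measurable fun x => F x i j) (hG : ∀ i j, Measurable fun x => G x i j)
    (i j : Fin N) : Measurable fun x => (F x * G x) i j := by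
  simp only [Matrix.mul_apply]
  exact Finset.measurable_sum _ fun l _ => (hF i l).mul (hG l j)

theorem measurable_pow_apply {β : Type*} [MeasurableSpace β] {F : β → Mat}
    (hF : ∀ i j, Measurable fun x => F x i j) (k : ℕ) (i j : Fin N) :
    Measurable fun x => (F x ^ k) i j := by
  induction k generalizing i j with
  | zero => simp
  | succ k ih => simpa only [pow_succ] using measurable_mul_apply ih hF i j

variable {α : Type*} [MeasurableSpace α]

theorem measurable_contractionProd_apply (δ : ℝ) {u : α → Fin N → ℝ} (hu : Measurable u)
    (m : ℕ) (i j : Fin N) : Measurable fun x => contractionProd δ u m x i j := by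
  induction m generalizing i j with
  | zero => simp [contractionProd]
  | succ m ih =>
    have hui : ∀ i, Measurable fun x => u x i := fun i => (measurable_pi_apply i).comp hu
    have h1 : ∀ i j, Measurable fun x : Fin (m + 1) → α =>
        rankOneContraction δ (u (x 0)) i j := by
      intro i j
      simp only [rankOneContraction, Matrix.sub_apply, Matrix.smul_apply, vecMulVec_apply,
        smul_eq_mul]
      have h0 : Measurable fun x : Fin (m + 1) → α => x 0 := measurable_pi_apply 0
      exact measurable_const.sub
        ((((hui i).comp h0).mul ((hui j).comp h0)).const_mul δ)
    have h2 : ∀ i j, Measurable fun x : Fin (m + 1) → α =>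
        contractionProd δ u m (Fin.tail x) i j := fun i j =>
      (ih i j).comp (measurable_pi_lambda _ fun l => measurable_pi_apply _)
    exact measurable_mul_apply h1 h2 i j

/-- Apply the second-moment bound to each row of `C = B^(2^k)`: the squared norms of the rows add up
to the trace of `B^(2^(k+1))`. -/
theorem lintegral_trace_conj_le (μ : Measure α) [IsProbabilityMeasure μ] {κ δ β : ℝ}
    (hκ : 0 < κ) (hδ : 0 ≤ δ) (hδκ : δ * κ ≤ 1) (k : ℕ)
    (hk : (2 * 2 ^ (k + 1) : ℕ) * (δ * κ) = Real.log 2)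
    {u : α → Fin N → ℝ} (hu : Measurable u) (huκ : ∀ x, u x ⬝ᵥ u x ≤ κ)
    (hβ : ∀ c : Fin N → ℝ, β * (c ⬝ᵥ c) ≤ ∫ x, (c ⬝ᵥ u x) ^ 2 ∂μ)
    (B : Mat) (hB : Bᵀ = B) :
    ∫⁻ x, ENNReal.ofReal (((rankOneContraction δ (u x) * B *
        rankOneContraction δ (u x)) ^ (2 ^ (k + 1))).trace) ∂μ ≤
      ENNReal.ofReal ((B ^ (2 ^ (k + 1))).trace * (1 - β / (2 * κ))) := by
  set C := B ^ 2 ^ k with hC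
  have hstep := fun x => trace_conj_rankOneContraction_pow_le hκ hδ hδκ k hk (u x) (huκ x) B hB
  have hui : ∀ i, Measurable fun x => u x i := fun i => (measurable_pi_apply i).comp hu
  have hmeas : ∀ c : Fin N → ℝ, Measurable fun x => (c ⬝ᵥ u x) ^ 2 := by
    intro c
    simp only [dotProduct]
    exact (Finset.measurable_sum _ fun i _ => (hui i).const_mul _).pow_const 2
  have hint : ∀ c : Fin N → ℝ, Integrable (fun x => (c ⬝ᵥ u x) ^ 2) μ := by
    intro c
    refine Integrable.of_bound (hmeas c).aestronglyMeasurable ((c ⬝ᵥ c) * κ) (ae_of_all _ fun x => ?_)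
    rw [Real.norm_eq_abs, abs_of_nonneg (sq_nonneg _)]
    refine (dotProduct_sq_le _ _).trans ?_
    have : 0 ≤ c ⬝ᵥ c := by
      simp only [dotProduct]; exact Finset.sum_nonneg fun i _ => mul_self_nonneg _
    gcongr
    exact huκ x
  calc _ ≤ ∫⁻ x, ENNReal.ofReal ((B ^ (2 ^ (k + 1))).trace -
        1 / (2 * κ) * ∑ i, (C i ⬝ᵥ u x) ^ 2) ∂μ :=
        lintegral_mono fun x => ENNReal.ofReal_le_ofReal (hstep x)
    _ = ENNReal.ofReal (∫ x, ((B ^ (2 ^ (k + 1))).trace -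
        1 / (2 * κ) * ∑ i, (C i ⬝ᵥ u x) ^ 2) ∂μ) := by
        rw [ofReal_integral_eq_lintegral_ofReal]
        · exact (integrable_const _).sub
            ((integrable_finsetSum _ fun i _ => hint (C i)).const_mul _)
        · refine ae_of_all _ fun x => le_trans ?_ (hstep x)
          rw [trace_pow_two_pow_eq_sum]
          · positivity
          · simp only [transpose_mul, transpose_rankOneContraction, hB, mul_assoc]
    _ ≤ _ := by
        apply ENNReal.ofReal_le_ofReal
        rw [integral_sub (integrable_const _)
          ((integrable_finsetSum _ fun i _ => hint (C i)).const_mul _), integral_const_mul,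
          integral_finsetSum _ fun i _ => hint (C i), integral_const]
        have h1 : β * (B ^ (2 ^ (k + 1))).trace ≤ ∑ i, ∫ x, (C i ⬝ᵥ u x) ^ 2 ∂μ := by
          rw [trace_pow_two_pow_eq_sum B hB, Finset.mul_sum]
          refine Finset.sum_le_sum fun i _ => le_trans (le_of_eq ?_) (hβ (C i))
          simp [dotProduct, sq, hC]
        have h2 := mul_le_mul_of_nonneg_left h1 (by positivity : 0 ≤ 1 / (2 * κ))
        simp only [probReal_univ, smul_eq_mul, one_mul]
        have h3 : β / (2 * κ) = 1 / (2 * κ) * β := by ring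
        rw [h3]
        linarith

/-- The first sample gives the outermost factor, so `ZZᵀ = D(Z'Z'ᵀ)D`. Integrating that sample with
the others frozen costs one factor `1 - β/(2κ)`; the initial value is the trace `N` of the identity.
-/
theorem lintegral_trace_contractionProd_le (μ : Measure α) [IsProbabilityMeasure μ] {κ δ β : ℝ}
    (hκ : 0 < κ) (hδ : 0 ≤ δ) (hδκ : δ * κ ≤ 1) (k : ℕ)
    (hk : (2 * 2 ^ (k + 1) : ℕ) * (δ * κ) = Real.log 2)
    {u : α → Fin N → ℝ} (hu : Measurable u) (huκ : ∀ x, u x ⬝ᵥ u x ≤ κ) (hβκ : β ≤ 2 * κ)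
    (hβ : ∀ c : Fin N → ℝ, β * (c ⬝ᵥ c) ≤ ∫ x, (c ⬝ᵥ u x) ^ 2 ∂μ) (m : ℕ) :
    ∫⁻ x, ENNReal.ofReal (((contractionProd δ u m x * (contractionProd δ u m x)ᵀ) ^
        (2 ^ (k + 1))).trace) ∂(Measure.pi fun _ : Fin m => μ) ≤
      ENNReal.ofReal (N * (1 - β / (2 * κ)) ^ m) := by
  have hγ : 0 ≤ 1 - β / (2 * κ) := by
    rw [sub_nonneg, div_le_one (by positivity)]; exact hβκ
  have hm : ∀ m, Measurable fun x => ENNReal.ofReal (((contractionProd δ u m x *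
      (contractionProd δ u m x)ᵀ) ^ (2 ^ (k + 1))).trace) := by
    intro m
    refine ENNReal.measurable_ofReal.comp ?_
    simp only [Matrix.trace, diag_apply]
    refine Finset.measurable_sum _ fun i _ => measurable_pow_apply (fun i j => ?_) _ i i
    exact measurable_mul_apply (measurable_contractionProd_apply δ hu m)
      (fun i j => measurable_contractionProd_apply δ hu m j i) i j
  induction m with
  | zero => simp [contractionProd]
  | succ m ih =>
    have hmp := measurePreserving_piFinSuccAbove (fun _ : Fin (m + 1) => μ) 0
    rw [← hmp.symm.lintegral_comp (hm (m + 1))]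
    have hmm : Measurable fun p : α × (Fin m → α) => ENNReal.ofReal
        (((contractionProd δ u (m + 1) ((MeasurableEquiv.piFinSuccAbove (fun _ => α) 0).symm p) *
      (contractionProd δ u (m + 1)
        ((MeasurableEquiv.piFinSuccAbove (fun _ => α) 0).symm p))ᵀ) ^ (2 ^ (k + 1))).trace) :=
      (hm (m + 1)).comp (MeasurableEquiv.measurable _)
    rw [lintegral_prod_symm _ hmm.aemeasurable]
    calc _ ≤ ∫⁻ y, ENNReal.ofReal (1 - β / (2 * κ)) *
          ENNReal.ofReal (((contractionProd δ u m y * (contractionProd δ u m y)ᵀ) ^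
            (2 ^ (k + 1))).trace) ∂(Measure.pi fun _ : Fin m => μ) := by
          refine lintegral_mono fun y => ?_
          rw [← ENNReal.ofReal_mul hγ, mul_comm (1 - β / (2 * κ))]
          refine le_trans (le_of_eq ?_) (lintegral_trace_conj_le μ hκ hδ hδκ k hk hu huκ hβ
            (contractionProd δ u m y * (contractionProd δ u m y)ᵀ) (by simp))
          refine lintegral_congr fun x => ?_
          simp only [contractionProd, transpose_mul, transpose_rankOneContraction,
            MeasurableEquiv.piFinSuccAbove]
          simp [mul_assoc, Fin.insertNthEquiv]
      _ ≤ ENNReal.ofReal (1 - β / (2 * κ)) * ENNReal.ofReal (N * (1 - β / (2 * κ)) ^ m) := by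
          rw [lintegral_const_mul _ (hm m)]
          gcongr
      _ = _ := by
          rw [← ENNReal.ofReal_mul hγ]; congr 1; ring

/-- Lower tail of the smallest eigenvalue of a sum of independent rank one matrices. -/
theorem measure_exists_sum_sq_lt_le (μ : Measure α) [IsProbabilityMeasure μ] {κ β : ℝ}
    (hκ : 0 < κ) {u : α → Fin N → ℝ} (hu : Measurable u) (huκ : ∀ x, u x ⬝ᵥ u x ≤ κ)
    (hβκ : β ≤ 2 * κ) (hβ : ∀ c : Fin N → ℝ, β * (c ⬝ᵥ c) ≤ ∫ x, (c ⬝ᵥ u x) ^ 2 ∂μ)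
    (m : ℕ) (s : ℝ) :
    (Measure.pi fun _ : Fin m => μ)
        {x | ∃ a : Fin N → ℝ, a ⬝ᵥ a = 1 ∧ ∑ i, (u (x i) ⬝ᵥ a) ^ 2 ≤ s} ≤
      ENNReal.ofReal (N * (1 - β / (2 * κ)) ^ m * Real.exp (Real.log 2 / κ * s)) := by
  set ℓ := Real.log 2 with hℓ
  have hℓ0 : 0 < ℓ := Real.log_pos one_lt_two
  have hℓ1 : ℓ ≤ 1 := Real.log_two_lt_d9.le.trans (by norm_num)
  set S := {x : Fin m → α | ∃ a : Fin N → ℝ, a ⬝ᵥ a = 1 ∧ ∑ i, (u (x i) ⬝ᵥ a) ^ 2 ≤ s}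
  set M : ℝ := N * (1 - β / (2 * κ)) ^ m with hM
  -- `1 + g p` is the lower bound `1 - δs - (mδκ)²` at `δ = log 2/(pκ)`, so its p-th power tends to
  -- `exp(-(log 2/κ)s)`.
  let g : ℕ → ℝ := fun p => -(ℓ / κ * s) / p - (m * ℓ) ^ 2 / p ^ 2
  have hg : Filter.Tendsto (fun p : ℕ => (p : ℝ) * g p) Filter.atTop (nhds (-(ℓ / κ * s))) := by
    have h1 : Filter.Tendsto (fun p : ℕ => -(ℓ / κ * s) - (m * ℓ) ^ 2 / (p : ℝ)) Filter.atTop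
        (nhds (-(ℓ / κ * s) - 0)) :=
      tendsto_const_nhds.sub (tendsto_const_div_atTop_nhds_zero_nat _)
    rw [sub_zero] at h1
    refine h1.congr' ?_
    filter_upwards [Filter.eventually_gt_atTop 0] with p hp
    have : (p : ℝ) ≠ 0 := by positivity
    simp only [g]; field_simp
  have hexp := Real.tendsto_one_add_pow_exp_of_tendsto hg
  have hg0 : Filter.Tendsto g Filter.atTop (nhds 0) := by
    have h1 : Filter.Tendsto (fun p : ℕ => -(ℓ / κ * s) / (p : ℝ)) Filter.atTop (nhds 0) :=
      tendsto_const_div_atTop_nhds_zero_nat _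
    have h2 : Filter.Tendsto (fun p : ℕ => (m * ℓ) ^ 2 / (p : ℝ) ^ 2) Filter.atTop (nhds 0) :=
      (tendsto_const_nhds (x := (m * ℓ) ^ 2)).div_atTop
        ((Filter.tendsto_pow_atTop two_ne_zero).comp tendsto_natCast_atTop_atTop)
    simpa using h1.sub h2
  have hsub : Filter.Tendsto (fun k : ℕ => 2 * 2 ^ (k + 1)) Filter.atTop Filter.atTop := by
    refine Filter.tendsto_atTop_mono (fun k => ?_) Filter.tendsto_id
    have := (Nat.lt_two_pow_self (n := k)).le
    simp only [id, pow_succ]; omega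
  have hlim := (hexp.comp hsub)
  have hev : ∀ᶠ k : ℕ in Filter.atTop, ENNReal.ofReal ((1 + g (2 * 2 ^ (k + 1))) ^ (2 * 2 ^ (k + 1))) *
      (Measure.pi fun _ : Fin m => μ) S ≤ ENNReal.ofReal M := by
    have h1 : ∀ᶠ k : ℕ in Filter.atTop, -1 < g (2 * 2 ^ (k + 1)) :=
      (hg0.comp hsub).eventually (lt_mem_nhds (by norm_num))
    filter_upwards [h1] with k hk
    set p := 2 * 2 ^ (k + 1) with hp
    have hp1 : 1 ≤ p := by rw [hp]; have := Nat.one_le_two_pow (n := k + 1); omega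
    have hp1' : (1 : ℝ) ≤ p := by exact_mod_cast hp1
    set δ : ℝ := ℓ / (p * κ) with hδdef
    have hδ : 0 ≤ δ := by positivity
    have hδκ' : δ * κ = ℓ / p := by rw [hδdef]; field_simp
    have hδκ : δ * κ ≤ 1 := by
      rw [hδκ', div_le_one (by positivity)]; linarith
    have hk' : ((2 * 2 ^ (k + 1) : ℕ) : ℝ) * (δ * κ) = Real.log 2 := by
      rw [← hp, hδκ', ← hℓ]; field_simp
    have hgk : 1 + g p = 1 - δ * s - (m * (δ * κ)) ^ 2 := by
      simp only [g]; rw [hδκ', hδdef]; field_simp; ring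
    have hI := lintegral_trace_contractionProd_le μ hκ hδ hδκ k hk' hu huκ hβκ hβ m
    -- Markov's inequality: on `S` the trace is at least `(1 + g p)^p`. Only an outer-measure
    -- inclusion is used, so `S` need not be measurable.
    refine le_trans ?_ hI
    refine le_trans ?_ (mul_meas_ge_le_lintegral₀ ?_
      (ENNReal.ofReal ((1 + g p) ^ p)))
    · gcongr
      rintro x ⟨a, ha, hx⟩
      simp only [Set.mem_ofPred_eq]
      apply ENNReal.ofReal_le_ofReal
      rw [hgk]
      exact pow_le_trace_contractionProd hκ hδ hδκ u huκ a ha m x k hx (by rw [← hgk]; linarith)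
    · refine (ENNReal.measurable_ofReal.comp ?_).aemeasurable
      simp only [Matrix.trace, diag_apply]
      refine Finset.measurable_sum _ fun i _ => measurable_pow_apply (fun i j => ?_) _ i i
      exact measurable_mul_apply (measurable_contractionProd_apply δ hu m)
        (fun i j => measurable_contractionProd_apply δ hu m j i) i j
  have hfin : (Measure.pi fun _ : Fin m => μ) S ≠ ∞ := measure_ne_top _ _
  have hlim2 : Filter.Tendsto (fun k : ℕ =>
      ENNReal.ofReal ((1 + g (2 * 2 ^ (k + 1))) ^ (2 * 2 ^ (k + 1))) *
      (Measure.pi fun _ : Fin m => μ) S) Filter.atTop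
      (nhds (ENNReal.ofReal (Real.exp (-(ℓ / κ * s))) * (Measure.pi fun _ : Fin m => μ) S)) :=
    ENNReal.Tendsto.mul_const (ENNReal.tendsto_ofReal hlim) (Or.inr hfin)
  have hle := le_of_tendsto hlim2 hev
  have hM0 : ENNReal.ofReal (M * Real.exp (ℓ / κ * s)) =
      ENNReal.ofReal (Real.exp (ℓ / κ * s)) * ENNReal.ofReal M := by
    rw [mul_comm, ENNReal.ofReal_mul (Real.exp_pos _).le]
  rw [hM0]
  calc (Measure.pi fun _ : Fin m => μ) S = ENNReal.ofReal (Real.exp (ℓ / κ * s)) *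
      (ENNReal.ofReal (Real.exp (-(ℓ / κ * s))) * (Measure.pi fun _ : Fin m => μ) S) := by
        rw [← mul_assoc, ← ENNReal.ofReal_mul (Real.exp_pos _).le, ← Real.exp_add]
        simp
    _ ≤ _ := by gcongr

end MatrixChernoffProbability

/-! ### Legendre polynomials: orthogonality, norms, growth outside `[-1, 1]`. -/

section Legendre

open Polynomial

/-- The Legendre polynomials. -/
noncomputable def legendre : ℕ → ℝ[X]
  | 0 => 1
  | 1 => X
  | k + 2 => C ((k : ℝ) + 2)⁻¹ *
      ((2 * (k : ℝ[X]) + 3) * X * legendre (k + 1) - ((k : ℝ[X]) + 1) * legendre k)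

theorem legendre_add_two (k : ℕ) : ((k : ℝ[X]) + 2) * legendre (k + 2) =
    (2 * (k : ℝ[X]) + 3) * X * legendre (k + 1) - ((k : ℝ[X]) + 1) * legendre k := by
  have h : ((k : ℝ[X]) + 2) = C ((k : ℝ) + 2) := by
    simp only [map_add, map_natCast, map_ofNat]
  have h0 : ((k : ℝ) + 2) ≠ 0 := by positivity
  rw [legendre, h, ← mul_assoc, ← C_mul, mul_inv_cancel₀ h0, C_1, one_mul]

theorem eval_legendre_add_two (k : ℕ) (x : ℝ) : ((k : ℝ) + 2) * (legendre (k + 2)).eval x =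
    (2 * (k : ℝ) + 3) * x * (legendre (k + 1)).eval x - ((k : ℝ) + 1) * (legendre k).eval x := by
  have h := congrArg (eval x) (legendre_add_two k)
  simpa using h

theorem degree_legendre (k : ℕ) : (legendre k).degree = k := by
  induction k using Nat.twoStepInduction with
  | zero => simp [legendre]
  | one => simp [legendre]
  | more k ih1 ih2 =>
    have h0 : ((k : ℝ) + 2)⁻¹ ≠ 0 := by positivity
    have h1 : (2 * (k : ℝ[X]) + 3) = C (2 * (k : ℝ) + 3) := by
      simp only [map_add, map_mul, map_natCast, map_ofNat]
    have h2 : ((k : ℝ[X]) + 1) = C ((k : ℝ) + 1) := by simp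
    have d1 : ((2 * (k : ℝ[X]) + 3) * X * legendre (k + 1)).degree = ((k + 2 : ℕ) : WithBot ℕ) := by
      rw [h1, mul_assoc, degree_C_mul (by positivity), degree_mul, degree_X, ih2]
      push_cast; ring
    rw [legendre, degree_C_mul h0, degree_sub_eq_left_of_degree_lt, d1]
    rw [d1, h2, degree_C_mul (by positivity), ih1]
    exact_mod_cast (by omega : k < k + 2)

/-- The recurrences close only as a pair: differentiating the three-term recurrence and using the
second gives the first one step later, which in turn gives the new second. -/
theorem derivative_legendre (k : ℕ) :
    derivative (legendre (k + 1)) =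
      X * derivative (legendre k) + ((k : ℝ[X]) + 1) * legendre k ∧
    X * derivative (legendre (k + 1)) - derivative (legendre k) =
      ((k : ℝ[X]) + 1) * legendre (k + 1) := by
  induction k with
  | zero => simp [legendre]
  | succ k ih =>
    obtain ⟨h1, h2⟩ := ih
    have hr := legendre_add_two k
    have hd := congrArg derivative hr
    simp only [derivative_mul, derivative_add, derivative_sub, derivative_natCast, derivative_X,
      derivative_ofNat, mul_zero, zero_mul, add_zero, zero_add, mul_one] at hd
    have h0 : ((k : ℝ[X]) + 2) ≠ 0 := by
      have : ((k + 2 : ℕ) : ℝ[X]) ≠ 0 := Nat.cast_ne_zero.2 (by omega)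
      exact_mod_cast this
    have h3 : derivative (legendre (k + 1 + 1)) =
        X * derivative (legendre (k + 1)) + (((k + 1 : ℕ) : ℝ[X]) + 1) * legendre (k + 1) := by
      apply mul_left_cancel₀ h0
      push_cast
      have e : derivative (1 : ℝ[X]) = 0 := derivative_one
      rw [e] at hd
      linear_combination hd + ((k : ℝ[X]) + 1) * h2
    refine ⟨h3, ?_⟩
    push_cast at h3 ⊢
    linear_combination X * h3 - hr + X * h2 - h1

theorem legendre_ode (k : ℕ) :
    derivative ((X ^ 2 - 1) * derivative (legendre k)) =
      (k : ℝ[X]) * ((k : ℝ[X]) + 1) * legendre k := by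
  rcases k with _ | k
  · simp [legendre]
  · obtain ⟨h1, h2⟩ := derivative_legendre k
    have h3 : (X ^ 2 - 1) * derivative (legendre (k + 1)) =
        ((k : ℝ[X]) + 1) * (X * legendre (k + 1) - legendre k) := by
      linear_combination X * h2 - h1
    rw [h3]
    simp only [derivative_mul, derivative_add, derivative_sub, derivative_natCast, derivative_X,
      derivative_one, zero_mul, add_zero, zero_add, one_mul]
    push_cast
    linear_combination ((k : ℝ[X]) + 1) * h2

/-- By the differential equation, the Wronskian-type `W` has derivative `(j(j+1) - k(k+1)) P_j P_k`,
and the factor `X² - 1` kills it at both endpoints. -/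
theorem integral_legendre_mul_of_ne {j k : ℕ} (hjk : j ≠ k) :
    ∫ x in (-1 : ℝ)..1, (legendre j).eval x * (legendre k).eval x = 0 := by
  set W : ℝ[X] := (X ^ 2 - 1) * derivative (legendre j) * legendre k -
    (X ^ 2 - 1) * derivative (legendre k) * legendre j with hW
  have hd : derivative W =
      ((j : ℝ[X]) * (j + 1) - k * (k + 1)) * (legendre j * legendre k) := by
    rw [hW, derivative_sub, derivative_mul, derivative_mul (f := _ * derivative (legendre k)),
      legendre_ode, legendre_ode]
    ring
  have hI := intervalIntegral.integral_eq_sub_of_hasDerivAt (a := -1) (b := 1)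
    (fun x _ => W.hasDerivAt x) ((derivative W).continuous.intervalIntegrable _ _)
  rw [hd] at hI
  have e1 : W.eval 1 = 0 := by simp [hW]
  have e2 : W.eval (-1) = 0 := by simp [hW]
  rw [e1, e2] at hI
  simp only [eval_mul, eval_sub, eval_add, eval_natCast, eval_one,
    intervalIntegral.integral_const_mul, sub_zero, mul_eq_zero] at hI
  refine hI.resolve_left fun h => hjk ?_
  have h2 : ((j : ℝ) - k) * (j + k + 1) = 0 := by linear_combination h
  rcases mul_eq_zero.1 h2 with h3 | h3
  · exact_mod_cast sub_eq_zero.1 h3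
  · exact absurd h3 (by positivity)

theorem eval_one_legendre (k : ℕ) : (legendre k).eval 1 = 1 := by
  induction k using Nat.twoStepInduction with
  | zero => simp [legendre]
  | one => simp [legendre]
  | more k ih1 ih2 =>
    have h := eval_legendre_add_two k 1
    rw [ih1, ih2] at h
    have h0 : ((k : ℝ) + 2) ≠ 0 := by positivity
    apply mul_left_cancel₀ h0
    linear_combination h

theorem eval_neg_legendre (k : ℕ) (x : ℝ) :
    (legendre k).eval (-x) = (-1) ^ k * (legendre k).eval x := by
  induction k using Nat.twoStepInduction with
  | zero => simp [legendre]
  | one => simp [legendre]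
  | more k ih1 ih2 =>
    have h := eval_legendre_add_two k x
    have h' := eval_legendre_add_two k (-x)
    rw [ih1, ih2] at h'
    have h0 : ((k : ℝ) + 2) ≠ 0 := by positivity
    apply mul_left_cancel₀ h0
    rw [pow_succ, pow_succ]
    rw [pow_succ] at h'
    linear_combination h' - (-1) ^ k * h

/-- Testing the three-term recurrence against its lowest and its highest term expresses two
consecutive norms through the same integral `∫ x P_{k+2} P_{k+1}`, which is then eliminated. -/
theorem integral_legendre_sq (k : ℕ) :
    (2 * (k : ℝ) + 1) * ∫ x in (-1 : ℝ)..1, (legendre k).eval x * (legendre k).eval x = 2 := by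
  have hii : ∀ p : ℝ[X], IntervalIntegrable (fun x => p.eval x) volume (-1) 1 :=
    fun p => p.continuous.intervalIntegrable _ _
  have h1 : ∀ k : ℕ, ((k : ℝ) + 1) *
      (∫ x in (-1 : ℝ)..1, (legendre k).eval x * (legendre k).eval x) =
      (2 * (k : ℝ) + 3) *
        ∫ x in (-1 : ℝ)..1, x * (legendre (k + 1)).eval x * (legendre k).eval x := by
    intro k
    have h0 := integral_legendre_mul_of_ne (show k + 2 ≠ k by omega)
    rw [← intervalIntegral.integral_const_mul, ← intervalIntegral.integral_const_mul, eq_comm,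
      ← sub_eq_zero, ← intervalIntegral.integral_sub]
    · rw [← mul_zero ((k : ℝ) + 2), ← h0, ← intervalIntegral.integral_const_mul]
      refine intervalIntegral.integral_congr fun x _ => ?_
      linear_combination -(legendre k).eval x * eval_legendre_add_two k x
    · exact Continuous.intervalIntegrable (by fun_prop) _ _
    · exact Continuous.intervalIntegrable (by fun_prop) _ _
  have h2 : ∀ k : ℕ, ((k : ℝ) + 2) *
      (∫ x in (-1 : ℝ)..1, (legendre (k + 2)).eval x * (legendre (k + 2)).eval x) =
      (2 * (k : ℝ) + 3) *
        ∫ x in (-1 : ℝ)..1, x * (legendre (k + 2)).eval x * (legendre (k + 1)).eval x := by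
    intro k
    have h0 := integral_legendre_mul_of_ne (show k + 2 ≠ k by omega)
    rw [← intervalIntegral.integral_const_mul, ← intervalIntegral.integral_const_mul, eq_comm,
      ← sub_eq_zero, ← intervalIntegral.integral_sub]
    · rw [← mul_zero ((k : ℝ) + 1), ← h0, ← intervalIntegral.integral_const_mul]
      refine intervalIntegral.integral_congr fun x _ => ?_
      linear_combination -(legendre (k + 2)).eval x * eval_legendre_add_two k x
    · exact Continuous.intervalIntegrable (by fun_prop) _ _
    · exact Continuous.intervalIntegrable (by fun_prop) _ _
  induction k with
  | zero => simp [legendre]; norm_num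
  | succ k ih =>
    rcases k with _ | k
    · have : ∫ x in (-1 : ℝ)..1, x * x = 2 / 3 := by
        simp only [← sq]; rw [integral_pow]; norm_num
      simp only [legendre, zero_add, eval_X, this]; norm_num
    · have a := h1 (k + 1)
      have b := h2 k
      push_cast at a b ih ⊢
      set I := ∫ x in (-1 : ℝ)..1, (legendre (k + 1)).eval x * (legendre (k + 1)).eval x
      set J := ∫ x in (-1 : ℝ)..1, (legendre (k + 2)).eval x * (legendre (k + 2)).eval x
      set B := ∫ x in (-1 : ℝ)..1, x * (legendre (k + 2)).eval x * (legendre (k + 1)).eval x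
      have h0 : ((k : ℝ) + 2) ≠ 0 := by positivity
      apply mul_left_cancel₀ h0
      have a' : ((k : ℝ) + 1 + 1) * I = (2 * ((k : ℝ) + 1) + 3) * B := a
      have e : (((k : ℝ) + 2) * ((2 * ((k : ℝ) + 1 + 1) + 1) * J)) = ((k : ℝ) + 2) * 2 := by
        linear_combination (2 * (k : ℝ) + 5) * b - (2 * (k : ℝ) + 3) * a' + ((k : ℝ) + 2) * ih
      exact e

theorem eval_legendre_sq_le_one (k : ℕ) {x : ℝ} (hx : |x| ≤ 1) : (legendre k).eval x ^ 2 ≤ 1 := by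
  rcases Nat.eq_zero_or_pos k with rfl | hk
  · simp [legendre]
  have key : ∀ y ∈ Icc (0 : ℝ) 1, (legendre k).eval y ^ 2 ≤ 1 := by
    set P := legendre k with hP
    -- An energy for the Legendre equation: its derivative is `2xP'²`, so it increases on `[0, 1]`
    -- up to its value `k(k+1)` at `1`.
    set F : ℝ[X] := ((k : ℝ[X]) * ((k : ℝ[X]) + 1)) * P ^ 2 +
      (1 - X ^ 2) * derivative P ^ 2 with hF
    have hd : derivative F = 2 * X * derivative P ^ 2 := by
      have h := legendre_ode k
      rw [← hP] at h
      simp only [derivative_mul, derivative_sub, derivative_X_pow, derivative_one] at h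
      simp only [hF, derivative_mul, derivative_add, derivative_sub, derivative_natCast,
        derivative_X, derivative_one, derivative_pow] at h ⊢
      simp only [Nat.cast_ofNat, map_ofNat, Nat.add_one_sub_one, pow_one] at h ⊢
      linear_combination (-2) * derivative P * h
    have hmono : MonotoneOn (fun y => F.eval y) (Icc 0 1) := by
      apply monotoneOn_of_deriv_nonneg (convex_Icc 0 1) F.continuous.continuousOn
        F.differentiable.differentiableOn
      intro y hy
      rw [interior_Icc] at hy
      rw [Polynomial.deriv, hd]
      simp only [eval_mul, eval_pow, eval_X, eval_ofNat]
      have := hy.1.le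
      positivity
    intro y hy
    have h := hmono hy (right_mem_Icc.2 zero_le_one) hy.2
    have h1 : P.eval 1 = 1 := eval_one_legendre k
    simp only [hF, eval_add, eval_mul, eval_pow, eval_sub, eval_one, eval_X, eval_natCast, h1] at h
    have hk' : (0 : ℝ) < k := by exact_mod_cast hk
    have h2 : 0 ≤ (1 - y ^ 2) * (derivative P).eval y ^ 2 :=
      mul_nonneg (by nlinarith [hy.1, hy.2]) (sq_nonneg _)
    have h3 : (k : ℝ) * (k + 1) * P.eval y ^ 2 ≤ k * (k + 1) * 1 := by linarith
    exact le_of_mul_le_mul_left h3 (by positivity)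
  rcases le_total 0 x with h | h
  · exact key x ⟨h, by rwa [abs_of_nonneg h] at hx⟩
  · have h1 := key (-x) ⟨by linarith, by rwa [abs_of_nonpos h] at hx⟩
    rw [eval_neg_legendre, mul_pow, ← pow_mul, mul_comm k, pow_mul] at h1
    simpa using h1

/-- The ratio bound reproduces itself: from `P_k ≥ ρ⁻¹P_{k+1}` and `(2k+3)x ≤ (k+1)(ρ + ρ⁻¹) + ρ`,
the recurrence leaves `(k+2)ρ P_{k+1}`. -/
theorem eval_legendre_growth {ρ x : ℝ} (hρ : 1 ≤ ρ) (hx1 : 1 ≤ x) (hx : x ≤ (ρ + ρ⁻¹) / 2)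
    (k : ℕ) : 0 < (legendre k).eval x ∧ (legendre k).eval x ≤ (legendre (k + 1)).eval x ∧
      (legendre (k + 1)).eval x ≤ ρ * (legendre k).eval x := by
  have hρ0 : 0 < ρ := by linarith
  have hρi : ρ⁻¹ ≤ 1 := inv_le_one_of_one_le₀ hρ
  induction k with
  | zero => simp [legendre, hx1]; linarith
  | succ k ih =>
    obtain ⟨h0, h1, h2⟩ := ih
    have h := eval_legendre_add_two k x
    set a := (legendre k).eval x
    set b := (legendre (k + 1)).eval x
    set c := (legendre (k + 2)).eval x with hc
    have hb : 0 < b := by linarith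
    have hk : (0 : ℝ) ≤ k := by positivity
    refine ⟨hb, ?_, ?_⟩
    · have e : ((k : ℝ) + 2) * b ≤ (k + 2) * c := by
        rw [h]
        nlinarith [mul_le_mul_of_nonneg_left h1 (by positivity : 0 ≤ (k : ℝ) + 1),
          mul_nonneg (by positivity : 0 ≤ 2 * (k : ℝ) + 3) (mul_nonneg hb.le (sub_nonneg.2 hx1))]
      exact le_of_mul_le_mul_left e (by positivity)
    · have e : ((k : ℝ) + 2) * c ≤ (k + 2) * (ρ * b) := by
        rw [h]
        have h3 : ρ⁻¹ * b ≤ a := by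
          rw [inv_mul_le_iff₀ hρ0]; exact h2
        have h4 := mul_le_mul_of_nonneg_left h3 (by positivity : 0 ≤ (k : ℝ) + 1)
        have h5 : (2 * (k : ℝ) + 3) * x ≤ (k + 1) * (ρ + ρ⁻¹) + ρ := by nlinarith
        have h6 := mul_le_mul_of_nonneg_right h5 hb.le
        nlinarith
      exact le_of_mul_le_mul_left e (by positivity)

theorem eval_legendre_sq_le {ρ x : ℝ} (hρ : 1 ≤ ρ) (hx : |x| ≤ (ρ + ρ⁻¹) / 2) (k : ℕ) :
    (legendre k).eval x ^ 2 ≤ (ρ ^ k) ^ 2 := by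
  rcases le_total |x| 1 with h | h
  · exact (eval_legendre_sq_le_one k h).trans (one_le_pow₀ (one_le_pow₀ hρ))
  · have h1 : ∀ k, (legendre k).eval |x| ≤ ρ ^ k := by
      intro k
      induction k with
      | zero => simp [legendre]
      | succ k ih =>
        refine (eval_legendre_growth hρ h hx k).2.2.trans ?_
        rw [pow_succ, mul_comm]
        gcongr
    have h2 : (legendre k).eval |x| ^ 2 ≤ (ρ ^ k) ^ 2 := by
      have := (eval_legendre_growth hρ h hx k).1.le
      gcongr
      exact h1 k
    rcases abs_choice x with hh | hh
    · rwa [hh] at h2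
    · rw [hh, eval_neg_legendre, mul_pow, ← pow_mul, mul_comm k, pow_mul] at h2
      simpa using h2

theorem sum_legendre_sq_le {ρ x : ℝ} (hρ : 1 ≤ ρ) (hx : |x| ≤ (ρ + ρ⁻¹) / 2) (n : ℕ) :
    ∑ k : Fin n, (2 * (k : ℝ) + 1) * (legendre k).eval x ^ 2 ≤ (n * ρ ^ n) ^ 2 := by
  have hs : ∀ n : ℕ, ∑ k ∈ Finset.range n, (2 * (k : ℝ) + 1) = n ^ 2 := by
    intro n
    induction n with
    | zero => simp
    | succ n ih => rw [Finset.sum_range_succ, ih]; push_cast; ring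
  calc _ ≤ ∑ k : Fin n, (2 * (k : ℝ) + 1) * (ρ ^ n) ^ 2 := by
        refine Finset.sum_le_sum fun k _ => ?_
        refine mul_le_mul_of_nonneg_left ?_ (by positivity)
        refine (eval_legendre_sq_le hρ hx k).trans ?_
        gcongr
        exact k.2.le
    _ = _ := by
        rw [← Finset.sum_mul, Fin.sum_univ_eq_sum_range (fun k => 2 * (k : ℝ) + 1), hs, mul_pow]

theorem exists_eval_eq_sum_legendre {n : ℕ} {q : ℂ[X]} (hq : q ∈ degreeLT ℂ n) :
    ∃ a : Fin n → ℂ, ∀ x : ℝ, q.eval (x : ℂ) = ∑ k, a k * ((legendre k).eval x : ℝ) := by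
  let S : Polynomial.Sequence ℂ := 
    { elems' := fun k => (legendre k).map (algebraMap ℝ ℂ)
      degree_eq' := fun k => by rw [degree_map, degree_legendre] }
  have hS := S.span_degreeLT (m := n) (fun i _ => (leadingCoeff_ne_zero.2 (S.ne_zero i)).isUnit)
  rw [← hS] at hq
  have e : (S : ℕ → ℂ[X]) '' Iio n = Set.range fun k : Fin n => S k := by
    ext p; simp [Fin.exists_iff]
  rw [e, Submodule.mem_span_range_iff_exists_fun] at hq
  obtain ⟨a, rfl⟩ := hq
  refine ⟨a, fun x => ?_⟩
  rw [eval_finsetSum]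
  refine Finset.sum_congr rfl fun k _ => ?_
  have : S k = (legendre k).map (algebraMap ℝ ℂ) := rfl
  rw [this, eval_smul, smul_eq_mul]
  congr 1
  rw [eval_map_algebraMap]
  exact aeval_algebraMap_apply_eq_algebraMap_eval x (legendre k)

end Legendre

/-! ### The orthonormal basis on `(-s, s)` and the Christoffel function. -/

section OrthonormalPolynomials

theorem unif_restrict {s : ℝ} (hs : s ≤ 1) :
    unif.restrict (Ioo (-s) s) = (2⁻¹ : ℝ≥0∞) • volume.restrict (Ioo (-s) s) := by
  rw [unif, Measure.restrict_smul, Measure.restrict_restrict measurableSet_Ioo, Ioo_inter_Ioo,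
    max_eq_left (by linarith), min_eq_left hs]

instance isProbabilityMeasure_unif : IsProbabilityMeasure unif := by
  constructor
  rw [unif, Measure.smul_apply, Measure.restrict_apply_univ, Real.volume_Ioo, smul_eq_mul]
  norm_num
  exact ENNReal.inv_mul_cancel two_ne_zero ENNReal.ofNat_ne_top

theorem integral_unif_restrict {s : ℝ} (hs0 : 0 ≤ s) (hs : s ≤ 1) (g : ℝ → ℝ) :
    ∫ x, g x ∂(unif.restrict (Ioo (-s) s)) = 2⁻¹ * ∫ x in (-s)..s, g x := by
  rw [unif_restrict hs, integral_smul_measure, intervalIntegral.integral_of_le (by linarith),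
    ← integral_Ioc_eq_integral_Ioo]
  simp

theorem integrable_unif_restrict {s : ℝ} {g : ℝ → ℝ} (hg : Continuous g) :
    Integrable g (unif.restrict (Ioo (-s) s)) := by
  refine Integrable.restrict ?_
  rw [unif]
  refine Integrable.smul_measure ?_ (by simp)
  exact (hg.integrableOn_Icc (a := -1) (b := 1)).mono_set Ioo_subset_Icc_self

/-- The orthonormal Legendre polynomials on `(-s, s)`, for the uniform measure on `(-1, 1)`. -/
noncomputable def orthoPoly (s : ℝ) (k : ℕ) (x : ℝ) : ℝ :=
  √((2 * k + 1) / s) * (legendre k).eval (x / s)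

theorem continuous_orthoPoly (s : ℝ) (k : ℕ) : Continuous (orthoPoly s k) := by
  unfold orthoPoly; fun_prop

theorem integral_orthoPoly_mul {s : ℝ} (hs0 : 0 < s) (hs : s ≤ 1) (j k : ℕ) :
    ∫ x, orthoPoly s j x * orthoPoly s k x ∂(unif.restrict (Ioo (-s) s)) =
      if j = k then 1 else 0 := by
  rw [integral_unif_restrict hs0.le hs]
  have h1 : ∀ x, orthoPoly s j x * orthoPoly s k x =
      √((2 * j + 1) / s) * √((2 * k + 1) / s) *
        (fun y => (legendre j).eval y * (legendre k).eval y) (x / s) := by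
    intro x; simp only [orthoPoly]; ring
  simp only [h1]
  rw [intervalIntegral.integral_const_mul, intervalIntegral.integral_comp_div
    (fun y => (legendre j).eval y * (legendre k).eval y) hs0.ne', neg_div,
    div_self hs0.ne']
  split_ifs with hjk
  · subst hjk
    have h2 := integral_legendre_sq j
    rw [Real.mul_self_sqrt (by positivity), smul_eq_mul]
    generalize (∫ x in (-1 : ℝ)..1, (legendre j).eval x * (legendre j).eval x) = I at h2 ⊢
    field_simp
    linear_combination h2
  · rw [integral_legendre_mul_of_ne hjk]; simp

theorem integral_sum_orthoPoly_sq {s : ℝ} (hs0 : 0 < s) (hs : s ≤ 1) {n : ℕ} (c : Fin n → ℝ) :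
    ∫ x, (∑ k : Fin n, c k * orthoPoly s k x) ^ 2 ∂(unif.restrict (Ioo (-s) s)) =
      ∑ k, c k ^ 2 := by
  have h : ∀ x, (∑ k : Fin n, c k * orthoPoly s k x) ^ 2 =
      ∑ j : Fin n, ∑ k : Fin n, c j * c k * (orthoPoly s j x * orthoPoly s k x) := by
    intro x
    rw [sq, Finset.sum_mul_sum]
    exact Finset.sum_congr rfl fun j _ => Finset.sum_congr rfl fun k _ => by ring
  simp only [h]
  have hc : ∀ j k : ℕ, Integrable (fun x => orthoPoly s j x * orthoPoly s k x)
      (unif.restrict (Ioo (-s) s)) := fun j k =>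
    integrable_unif_restrict ((continuous_orthoPoly s j).mul (continuous_orthoPoly s k))
  rw [integral_finsetSum _ fun (j : Fin n) _ => integrable_finsetSum _
    fun (k : Fin n) _ => (hc j k).const_mul _]
  refine Finset.sum_congr rfl fun j _ => ?_
  rw [integral_finsetSum _ fun (k : Fin n) _ => (hc j k).const_mul _]
  simp only [integral_const_mul, integral_orthoPoly_mul hs0 hs, Fin.val_inj]
  simp [sq]

theorem sum_orthoPoly_sq_le {r s : ℝ} {n : ℕ} (hn : n ≠ 0) (hr : 1 < r) (hs2 : 1 / 2 ≤ s)
    (hs : s⁻¹ ≤ (r ^ (1 / (n : ℝ)) + (r ^ (1 / (n : ℝ)))⁻¹) / 2) {x : ℝ} (hx : |x| ≤ 1) :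
    ∑ k : Fin n, orthoPoly s k x ^ 2 ≤ 2 * (n * r) ^ 2 := by
  have hs0 : 0 < s := by linarith
  set ρ := r ^ (1 / (n : ℝ)) with hρ
  have hρ1 : 1 ≤ ρ := Real.one_le_rpow hr.le (by positivity)
  have hρn : ρ ^ n = r := by
    rw [hρ, one_div, Real.rpow_inv_natCast_pow (by linarith) hn]
  have hxs : |x / s| ≤ (ρ + ρ⁻¹) / 2 := by
    refine le_trans ?_ hs
    rw [abs_div, abs_of_pos hs0, div_eq_mul_inv]
    have : 0 ≤ s⁻¹ := by positivity
    nlinarith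
  have h := sum_legendre_sq_le hρ1 hxs n
  rw [hρn] at h
  have e : ∀ k : Fin n, orthoPoly s k x ^ 2 =
      s⁻¹ * ((2 * (k : ℝ) + 1) * (legendre k).eval (x / s) ^ 2) := by
    intro k
    rw [orthoPoly, mul_pow, Real.sq_sqrt (by positivity)]
    ring
  simp only [e]
  rw [← Finset.mul_sum]
  have h2 : s⁻¹ ≤ 2 := by
    rw [inv_le_comm₀ hs0 two_pos]; linarith
  gcongr

theorem mem_polySpace_iff {n : ℕ} {s : ℝ} (hs0 : 0 < s) {p : ℝ → ℂ} :
    p ∈ polySpace n ↔ ∃ a : Fin n → ℂ, ∀ x, p x = ∑ k, a k * (orthoPoly s k x : ℂ) := by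
  have hsc : (s : ℂ) ≠ 0 := by exact_mod_cast hs0.ne'
  constructor
  · rintro ⟨q, hq, rfl⟩
    have hq' : q.comp (Polynomial.C (s : ℂ) * Polynomial.X) ∈ Polynomial.degreeLT ℂ n := by
      have hq := Polynomial.mem_degreeLT.1 hq
      rw [Polynomial.mem_degreeLT]
      refine lt_of_le_of_lt ?_ hq
      rcases eq_or_ne q 0 with rfl | h0
      · simp
      · refine Polynomial.degree_le_natDegree.trans ?_
        rw [Polynomial.natDegree_comp, Polynomial.natDegree_C_mul_X _ hsc, mul_one,
          Polynomial.degree_eq_natDegree h0]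
    obtain ⟨a, ha⟩ := exists_eval_eq_sum_legendre hq'
    refine ⟨fun k => a k / (√((2 * (k : ℕ) + 1) / s) : ℝ), fun x => ?_⟩
    have h1 := ha (x / s)
    rw [Polynomial.eval_comp] at h1
    simp only [Polynomial.eval_mul, Polynomial.eval_C, Polynomial.eval_X] at h1
    have e : (s : ℂ) * ((x / s : ℝ) : ℂ) = x := by push_cast; field_simp
    rw [e] at h1
    have : polyFun q x = q.eval (x : ℂ) := rfl
    rw [this, h1]
    refine Finset.sum_congr rfl fun k _ => ?_
    have hk : ((√((2 * (k : ℕ) + 1) / s) : ℝ) : ℂ) ≠ 0 := by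
      have : (√((2 * (k : ℕ) + 1) / s) : ℝ) ≠ 0 := (Real.sqrt_pos.2 (by positivity)).ne'
      exact_mod_cast this
    rw [orthoPoly, Complex.ofReal_mul]
    field_simp
  · rintro ⟨a, ha⟩
    have hk : ∀ k : Fin n, (fun x => (orthoPoly s k x : ℂ)) ∈ polySpace n := by
      intro k
      set q : Polynomial ℂ := Polynomial.C ((√((2 * (k : ℕ) + 1) / s) : ℝ) : ℂ) *
        ((legendre k).map (algebraMap ℝ ℂ)).comp (Polynomial.C (s : ℂ)⁻¹ * Polynomial.X)
      refine ⟨q, ?_, ?_⟩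
      · rw [SetLike.mem_coe, Polynomial.mem_degreeLT]
        refine lt_of_le_of_lt Polynomial.degree_le_natDegree ?_
        refine lt_of_le_of_lt (Nat.cast_le.2 (Polynomial.natDegree_C_mul_le _ _)) ?_
        rw [Polynomial.natDegree_comp, Polynomial.natDegree_C_mul_X _ (inv_ne_zero hsc), mul_one,
          Polynomial.natDegree_map,
          Polynomial.natDegree_eq_of_degree_eq_some (degree_legendre k)]
        exact_mod_cast k.2
      · ext x
        have : polyFun q x = q.eval (x : ℂ) := rfl
        rw [this, Polynomial.eval_mul, Polynomial.eval_C, Polynomial.eval_comp]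
        simp only [Polynomial.eval_mul, Polynomial.eval_C, Polynomial.eval_X]
        have e : (s : ℂ)⁻¹ * (x : ℂ) = ((x / s : ℝ) : ℂ) := by push_cast; ring
        rw [e, Polynomial.eval_map_algebraMap, orthoPoly, Complex.ofReal_mul]
        congr 1
        exact Polynomial.aeval_algebraMap_apply_eq_algebraMap_eval (x / s) (legendre k)
    have : p = ∑ k, a k • (fun x => (orthoPoly s k x : ℂ)) := by
      ext x; rw [ha]; simp
    rw [this]
    exact Submodule.sum_mem _ fun k _ => Submodule.smul_mem _ _ (hk k)

theorem eLpNorm_two_sq (f : ℝ → ℂ) (ν : Measure ℝ) :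
    eLpNorm f 2 ν ^ 2 = ∫⁻ x, ‖f x‖ₑ ^ 2 ∂ν := by
  have h := eLpNorm_nnreal_pow_eq_lintegral (μ := ν) (f := f) (p := 2) two_ne_zero
  simpa using h

/-- The normalised reproducing kernel at `x` is the extremal test polynomial. This direction
suffices, because the Christoffel function only occurs as an upper bound. -/
theorem ofReal_sum_sq_le_christoffel {n : ℕ} {s : ℝ} (hs0 : 0 < s) (hs : s ≤ 1) (x : ℝ) :
    ENNReal.ofReal (∑ k : Fin n, orthoPoly s k x ^ 2) ≤
      christoffel (polySpace n) (unif.restrict (Ioo (-s) s)) x := by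
  set K := ∑ k : Fin n, orthoPoly s k x ^ 2 with hK
  rcases eq_or_lt_of_le (show 0 ≤ K by positivity) with h0 | h0
  · rw [← h0]; simp
  let g : ℝ → ℝ := fun y => ∑ k : Fin n, orthoPoly s k x / √K * orthoPoly s k y
  have hsum : ∑ k : Fin n, (orthoPoly s k x / √K) ^ 2 = 1 := by
    simp only [div_pow, Real.sq_sqrt h0.le]
    rw [← Finset.sum_div, ← hK, div_self h0.ne']
  have hgx : g x = √K := by
    have : g x = K / √K := by
      simp only [g, hK, Finset.sum_div]
      exact Finset.sum_congr rfl fun k _ => by ring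
    rw [this, Real.div_sqrt]
  have hgc : Continuous g :=
    continuous_finsetSum _ fun k _ => continuous_const.mul (continuous_orthoPoly s k)
  have hmem : (fun y => (g y : ℂ)) ∈ polySpace n :=
    (mem_polySpace_iff hs0).2 ⟨fun k => ((orthoPoly s k x / √K : ℝ) : ℂ), fun y => by
      simp only [g]; push_cast; rfl⟩
  have hnorm : ∀ y, ‖(g y : ℂ)‖ₑ ^ 2 = ENNReal.ofReal (g y ^ 2) := by
    intro y
    rw [← ofReal_norm, Complex.norm_real, ← ENNReal.ofReal_pow (norm_nonneg _),
      Real.norm_eq_abs, sq_abs]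
  have hint : eLpNorm (fun y => (g y : ℂ)) 2 (unif.restrict (Ioo (-s) s)) ^ 2 = 1 := by
    rw [eLpNorm_two_sq]
    simp only [hnorm]
    rw [← ofReal_integral_eq_lintegral_ofReal (f := fun y => g y ^ 2)
      (integrable_unif_restrict (hgc.pow 2))
      (ae_of_all _ fun y => sq_nonneg _)]
    simp only [g]
    rw [integral_sum_orthoPoly_sq hs0 hs, hsum, ENNReal.ofReal_one]
  have hval : ENNReal.ofReal K = ‖(g x : ℂ)‖ₑ ^ 2 := by
    rw [hnorm, hgx, Real.sq_sqrt h0.le]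
  rw [hval]
  exact le_iSup₂_of_le (f := fun (p : ℝ → ℂ) (_ : p ∈ {p | p ∈ polySpace n ∧
    eLpNorm p 2 (unif.restrict (Ioo (-s) s)) ^ 2 = 1}) => ‖p x‖ₑ ^ 2)
    (fun y => (g y : ℂ)) ⟨hmem, hint⟩ le_rfl

/-- The choice of `σ` keeps the growth of polynomials outside `(-(1-σ), 1-σ)` below `r`. -/
theorem domain_shrink_bounds {r σ : ℝ} (hr : 1 < r) {n : ℕ}
    (hn : Real.log r / Real.log (1 + √8) ≤ n)
    (hσ : σ ≤ (r ^ (1 / (n : ℝ)) - 1) ^ 2 / 16) :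
    n ≠ 0 ∧ 1 / 2 ≤ 1 - σ ∧
      (1 - σ)⁻¹ ≤ (r ^ (1 / (n : ℝ)) + (r ^ (1 / (n : ℝ)))⁻¹) / 2 := by
  have h8 : √8 ^ 2 = (8 : ℝ) := Real.sq_sqrt (by norm_num)
  have h80 : 0 < √(8 : ℝ) := Real.sqrt_pos.2 (by norm_num)
  have h83 : √(8 : ℝ) < 3 := by nlinarith
  have hl8 : 0 < Real.log (1 + √8) := Real.log_pos (by linarith)
  have hlr : 0 < Real.log r := Real.log_pos hr
  have hn0 : (0 : ℝ) < n := lt_of_lt_of_le (div_pos hlr hl8) hn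
  have hn1 : n ≠ 0 := by rintro rfl; simp at hn0
  set ρ := r ^ (1 / (n : ℝ)) with hρ
  have hρ1 : 1 < ρ := Real.one_lt_rpow hr (by positivity)
  -- The lower bound on `n` is equivalent to this, and it forces `σ ≤ 8/16 = 1/2`.
  have hρ8 : ρ ≤ 1 + √8 := by
    rw [← Real.log_le_log_iff (by linarith) (by linarith), hρ, Real.log_rpow (by linarith),
      one_div, inv_mul_le_iff₀ hn0]
    rwa [div_le_iff₀ hl8] at hn
  obtain ⟨t, ht⟩ : ∃ t, t = ρ - 1 := ⟨_, rfl⟩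
  have hρt : ρ = 1 + t := by linarith
  rw [hρt] at hσ hρ1 hρ8 ⊢
  have ht0 : 0 < t := by linarith
  have ht8 : t ≤ √8 := by linarith
  have ht2 : t ^ 2 ≤ 8 := by nlinarith
  have hσ' : σ ≤ t ^ 2 / 16 := by
    have : 1 + t - 1 = t := by ring
    rwa [this] at hσ
  have hs : 1 / 2 ≤ 1 - σ := by linarith
  refine ⟨hn1, hs, ?_⟩
  have hpos : 0 < 1 - t ^ 2 / 16 := by linarith
  calc (1 - σ)⁻¹ ≤ (1 - t ^ 2 / 16)⁻¹ := by gcongr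
    _ ≤ _ := by
      have e : (1 + t + (1 + t)⁻¹) / 2 = (1 + (1 + t) ^ 2) / (2 * (1 + t)) := by field_simp; ring
      rw [e, inv_eq_one_div, div_le_div_iff₀ hpos (by positivity)]
      -- After clearing denominators the claim is `t²(14 - 2t - t²) ≥ 0`, true for `t ≤ √8`.
      nlinarith [mul_pos ht0 ht0, mul_nonneg (sq_nonneg t) (by nlinarith : 0 ≤ 14 - 2 * t - t ^ 2)]

end OrthonormalPolynomials

/-! ### Weighted least squares on a fixed sample. -/

section LeastSquares

variable {m : ℕ}

/-- The vector of samples `z`, weighted by the square roots of `W`. -/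
noncomputable def weightedVec (W : Fin m → ℝ) (z : Fin m → ℂ) : EuclideanSpace ℂ (Fin m) :=
  WithLp.toLp 2 fun i => ((√(W i) : ℝ) : ℂ) * z i

theorem norm_weightedVec_sq {W : Fin m → ℝ} (hW : ∀ i, 0 ≤ W i) (z : Fin m → ℂ) :
    ‖weightedVec W z‖ ^ 2 = ∑ i, W i * ‖z i‖ ^ 2 := by
  rw [EuclideanSpace.norm_sq_eq]
  refine Finset.sum_congr rfl fun i _ => ?_
  simp only [weightedVec, norm_mul, mul_pow, Complex.norm_real, Real.norm_eq_abs, sq_abs]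
  rw [Real.sq_sqrt (hW i)]

theorem weightedVec_add (W : Fin m → ℝ) (z z' : Fin m → ℂ) :
    weightedVec W (z + z') = weightedVec W z + weightedVec W z' := by
  ext i; simp [weightedVec, mul_add]

theorem weightedVec_sub (W : Fin m → ℝ) (z z' : Fin m → ℂ) :
    weightedVec W (z - z') = weightedVec W z - weightedVec W z' := by
  ext i; simp [weightedVec, mul_sub]

theorem wlsObjective_eq {w : ℝ → ℝ≥0∞} {x : Fin m → ℝ} (hw : ∀ i, w (x i) ≠ ∞)
    (y : Fin m → ℂ) (p : ℝ → ℂ) :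
    wlsObjective w x y p = (m : ℝ≥0∞)⁻¹ *
      ENNReal.ofReal (‖weightedVec (fun i => (w (x i)).toReal) (y - p ∘ x)‖ ^ 2) := by
  rw [norm_weightedVec_sq (fun i => ENNReal.toReal_nonneg), wlsObjective,
    ENNReal.ofReal_sum_of_nonneg (fun i _ => by positivity)]
  congr 1
  refine Finset.sum_congr rfl fun i _ => ?_
  rw [ENNReal.ofReal_mul ENNReal.toReal_nonneg, ENNReal.ofReal_toReal (hw i),
    ENNReal.ofReal_pow (norm_nonneg _), ofReal_norm]
  rfl

/-- Project the data onto the image of `P` under weighted sampling, a finite-dimensional and hence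
complete subspace. Injectivity of sampling plays no role. -/
theorem exists_isWLSMinimizer (P : Submodule ℂ (ℝ → ℂ)) {w : ℝ → ℝ≥0∞} {x : Fin m → ℝ}
    (hw : ∀ i, w (x i) ≠ ∞) (y : Fin m → ℂ) : ∃ g, IsWLSMinimizer P w x y g := by
  set W : Fin m → ℝ := fun i => (w (x i)).toReal with hW
  let T : (ℝ → ℂ) →ₗ[ℂ] EuclideanSpace ℂ (Fin m) :=
    { toFun := fun p => weightedVec W (p ∘ x)
      map_add' := fun p q => weightedVec_add W (p ∘ x) (q ∘ x)
      map_smul' := fun a p => by ext i; simp [weightedVec]; ring }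
  have hT : ∀ p, T p = weightedVec W (p ∘ x) := fun p => rfl
  obtain ⟨v, hv, hmin⟩ := (P.map T).exists_norm_eq_iInf_of_complete_subspace
    (Submodule.complete_of_finiteDimensional _) (weightedVec W y)
  obtain ⟨g, hg, rfl⟩ := hv
  refine ⟨g, hg, fun p hp => ?_⟩
  simp only [mem_ofPred_eq]
  rw [wlsObjective_eq hw, wlsObjective_eq hw]
  gcongr
  rw [weightedVec_sub, weightedVec_sub, ← hT, ← hT, hmin]
  exact ciInf_le ⟨0, by rintro _ ⟨q, rfl⟩; positivity⟩
    (⟨T p, Submodule.mem_map_of_mem hp⟩ : P.map T)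

/-- `h - g` is the difference of the residuals of `g` and `h`, and minimality makes that of `h` no
larger; hence the factor `2`. -/
theorem norm_weightedVec_sub_le_of_isWLSMinimizer {P : Submodule ℂ (ℝ → ℂ)} {w : ℝ → ℝ≥0∞}
    {x : Fin m → ℝ} (hw : ∀ i, w (x i) ≠ ∞) {f g h : ℝ → ℂ} (hg : g ∈ P)
    (e : EuclideanSpace ℂ (Fin m))
    (hh : IsWLSMinimizer P w x (fun i => f (x i) + e i) h) {R G : ℝ} (hG : 0 ≤ G)
    (hR : ∀ i, (w (x i)).toReal ≤ R)
    (hf : ∑ i, (w (x i)).toReal * ‖f (x i) - g (x i)‖ ^ 2 ≤ R * G ^ 2) :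
    ‖weightedVec (fun i => (w (x i)).toReal) ((h - g) ∘ x)‖ ≤ 2 * (√R * (G + ‖e‖)) := by
  rcases Nat.eq_zero_or_pos m with rfl | hm
  · have h0 : ‖weightedVec (fun i => (w (x i)).toReal) ((h - g) ∘ x)‖ ^ 2 = 0 := by
      rw [norm_weightedVec_sq (fun i => ENNReal.toReal_nonneg)]; simp
    rw [pow_eq_zero_iff two_ne_zero] at h0
    rw [h0]; positivity
  have hR0 : 0 ≤ R := ENNReal.toReal_nonneg.trans (hR ⟨0, hm⟩)
  set W : Fin m → ℝ := fun i => (w (x i)).toReal with hW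
  have hW0 : ∀ i, 0 ≤ W i := fun i => ENNReal.toReal_nonneg
  set y : Fin m → ℂ := fun i => f (x i) + e i with hy
  have hmin : ‖weightedVec W (y - h ∘ x)‖ ≤ ‖weightedVec W (y - g ∘ x)‖ := by
    have h1 := hh.2 hg
    simp only [mem_ofPred_eq] at h1
    rw [wlsObjective_eq hw, wlsObjective_eq hw, ENNReal.mul_le_mul_iff_right
      (ENNReal.inv_ne_zero.2 (ENNReal.natCast_ne_top m))
      (ENNReal.inv_ne_top.2 (Nat.cast_ne_zero.2 hm.ne')),
      ENNReal.ofReal_le_ofReal_iff (by positivity)] at h1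
    exact (pow_le_pow_iff_left₀ (norm_nonneg _) (norm_nonneg _) two_ne_zero).1 h1
  have hsplit : weightedVec W (y - g ∘ x) =
      weightedVec W ((f - g) ∘ x) + weightedVec W (fun i => e i) := by
    rw [← weightedVec_add]; congr 1; ext i; simp [hy]; ring
  have h1 : ‖weightedVec W ((f - g) ∘ x)‖ ≤ √R * G := by
    refine (pow_le_pow_iff_left₀ (norm_nonneg _) (by positivity) two_ne_zero).1 ?_
    rw [norm_weightedVec_sq hW0, mul_pow, Real.sq_sqrt hR0]
    exact hf
  have h2 : ‖weightedVec W (fun i => e i)‖ ≤ √R * ‖e‖ := by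
    refine (pow_le_pow_iff_left₀ (norm_nonneg _) (by positivity) two_ne_zero).1 ?_
    rw [norm_weightedVec_sq hW0, mul_pow, Real.sq_sqrt hR0, EuclideanSpace.norm_sq_eq,
      Finset.mul_sum]
    exact Finset.sum_le_sum fun i _ => mul_le_mul_of_nonneg_right (hR i) (by positivity)
  have h3 : ‖weightedVec W (y - g ∘ x)‖ ≤ √R * (G + ‖e‖) := by
    rw [hsplit, mul_add]
    exact (norm_add_le _ _).trans (add_le_add h1 h2)
  have h4 : weightedVec W ((h - g) ∘ x) =
      weightedVec W (y - g ∘ x) - weightedVec W (y - h ∘ x) := by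
    rw [← weightedVec_sub]; congr 1; ext i; simp
  rw [h4]
  refine (norm_sub_le _ _).trans ?_
  linarith

/-- A lower bound for real coefficient vectors extends to complex ones. -/
theorem mul_sum_norm_sq_le_of_real {n : ℕ} {b : Fin m → Fin n → ℝ} {t : ℝ}
    (h : ∀ a : Fin n → ℝ, ∑ k, a k ^ 2 = 1 → t ≤ ∑ i, (∑ k, b i k * a k) ^ 2)
    (a : Fin n → ℂ) :
    t * ∑ k, ‖a k‖ ^ 2 ≤ ∑ i, ‖∑ k, (b i k : ℂ) * a k‖ ^ 2 := by
  have key : ∀ a : Fin n → ℝ, t * ∑ k, a k ^ 2 ≤ ∑ i, (∑ k, b i k * a k) ^ 2 := by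
    intro a
    set S := ∑ k, a k ^ 2 with hS
    rcases eq_or_lt_of_le (show 0 ≤ S by positivity) with h0 | h0
    · rw [← h0, mul_zero]; positivity
    · have h1 := h (fun k => a k / √S) (by
        simp only [div_pow, Real.sq_sqrt h0.le]
        rw [← Finset.sum_div, ← hS, div_self h0.ne'])
      have h2 : ∀ i, (∑ k, b i k * (a k / √S)) ^ 2 = (∑ k, b i k * a k) ^ 2 / S := by
        intro i
        have : ∑ k, b i k * (a k / √S) = (∑ k, b i k * a k) / √S := by
          rw [Finset.sum_div]; exact Finset.sum_congr rfl fun k _ => by ring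
        rw [this, div_pow, Real.sq_sqrt h0.le]
      simp only [h2] at h1
      rwa [← Finset.sum_div, le_div_iff₀ h0] at h1
  have h1 := key fun k => (a k).re
  have h2 := key fun k => (a k).im
  have e1 : ∀ z : ℂ, ‖z‖ ^ 2 = z.re ^ 2 + z.im ^ 2 := by
    intro z; rw [Complex.sq_norm, Complex.normSq_apply]; ring
  simp only [e1, Finset.sum_add_distrib, mul_add, Complex.re_sum, Complex.im_sum,
    Complex.re_ofReal_mul, Complex.im_ofReal_mul]
  linarith

end LeastSquares

/-! ### Markov bounds for sums over i.i.d. samples. -/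

section Sampling

theorem measure_lt_lintegral_div_le {β : Type*} [MeasurableSpace β] (ν : Measure β)
    {F : β → ℝ≥0∞} (hF : AEMeasurable F ν) {J δ : ℝ≥0∞} (hJ : ∫⁻ x, F x ∂ν ≤ J) (hJt : J ≠ ∞)
    (hδ : δ ≠ 0) (hδt : δ ≠ ∞) : ν {x | J / δ < F x} ≤ δ := by
  rcases eq_or_ne J 0 with rfl | h0
  · have h1 := (lintegral_eq_zero_iff' hF).1 (le_antisymm hJ bot_le)
    have h2 : ν {x | 0 / δ < F x} = 0 := by
      refine measure_mono_null (fun x hx => ?_) (ae_iff.1 h1)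
      simp only [ENNReal.zero_div, mem_ofPred_eq] at hx
      exact hx.ne'
    rw [h2]; exact bot_le
  · have h1 := mul_meas_ge_le_lintegral₀ hF (J / δ)
    have h2 : J / δ * ν {x | J / δ < F x} ≤ J / δ * δ := by
      rw [ENNReal.div_mul_cancel hδ hδt]
      refine le_trans ?_ (h1.trans hJ)
      gcongr with x
      exact fun h => h.le
    exact (ENNReal.mul_le_mul_iff_right (ENNReal.div_ne_zero.2 ⟨h0, hδt⟩)
      (ENNReal.div_ne_top hJt hδ)).1 h2

variable (μ : Measure ℝ) [IsProbabilityMeasure μ] (m : ℕ)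

theorem aemeasurable_comp_eval {F : ℝ → ℝ≥0∞} (hF : AEMeasurable F μ) (i : Fin m) :
    AEMeasurable (fun x : Fin m → ℝ => F (x i)) (sampleLaw m μ) :=
  hF.comp_quasiMeasurePreserving
    (measurePreserving_eval (fun _ : Fin m => μ) i).quasiMeasurePreserving

theorem lintegral_sampleLaw_sum {F : ℝ → ℝ≥0∞} (hF : AEMeasurable F μ) :
    ∫⁻ x, ∑ i, F (x i) ∂(sampleLaw m μ) = m * ∫⁻ t, F t ∂μ := by
  rw [lintegral_finsetSum' _ fun i _ => aemeasurable_comp_eval μ m hF i]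
  have h : ∀ i : Fin m, ∫⁻ x, F (x i) ∂(sampleLaw m μ) = ∫⁻ t, F t ∂μ := by
    intro i
    have hp := measurePreserving_eval (fun _ : Fin m => μ) i
    have hmap : (sampleLaw m μ).map (Function.eval i) = μ := hp.map_eq
    conv_rhs => rw [← hmap]
    rw [lintegral_map' (by rw [hmap]; exact hF) hp.measurable.aemeasurable]
  simp [h]

theorem ae_sampleLaw_of_ae {p : ℝ → Prop} (hp : ∀ᵐ t ∂μ, p t) :
    ∀ᵐ x ∂(sampleLaw m μ), ∀ i, p (x i) :=
  ae_all_iff.2 fun i =>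
    (measurePreserving_eval (fun _ : Fin m => μ) i).quasiMeasurePreserving.ae hp

theorem measure_sum_gt_le {F : ℝ → ℝ≥0∞} (hF : AEMeasurable F μ) {J δ : ℝ≥0∞}
    (hJ : ∫⁻ t, F t ∂μ ≤ J) (hJt : J ≠ ∞) (hδ : δ ≠ 0) (hδt : δ ≠ ∞) :
    sampleLaw m μ {x | m * J / δ < ∑ i, F (x i)} ≤ δ := by
  refine measure_lt_lintegral_div_le _ ?_ ?_ (ENNReal.mul_ne_top (ENNReal.natCast_ne_top m) hJt)
    hδ hδt
  · exact Finset.aemeasurable_fun_sum _ fun i _ => aemeasurable_comp_eval μ m hF i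
  · rw [lintegral_sampleLaw_sum μ m hF]; gcongr

/-- Only an inequality, because `v * v⁻¹` is `0` where `v` is `0` or `∞`. -/
theorem lintegral_weight_mul_le {ν : Measure ℝ} {v : ℝ → ℝ≥0∞} (hv : AEMeasurable v ν)
    {F : ℝ → ℝ≥0∞} (hF : AEMeasurable F ν) :
    ∫⁻ t, weight v t * F t ∂(ν.withDensity v) ≤ ∫⁻ t, F t ∂ν := by
  rw [lintegral_withDensity_eq_lintegral_mul₀ hv (g := fun t => weight v t * F t) (hv.inv.mul hF)]
  refine lintegral_mono fun t => ?_
  simp only [Pi.mul_apply, weight]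
  rw [← mul_assoc]
  exact mul_le_of_le_one_left bot_le (ENNReal.mul_inv_le_one _)

end Sampling

/-! ### Chernoff bound for the weighted orthonormal polynomials. -/

section SampleVectors

open Matrix

/-- The weighted orthonormal polynomials at a sample point in `A`, and `0` outside `A`. -/
noncomputable def sampleVec (A : Set ℝ) (v : ℝ → ℝ≥0∞) (s : ℝ) (n : ℕ) (t : ℝ) : Fin n → ℝ :=
  fun k => A.indicator (fun t => √(weight v t).toReal * orthoPoly s k t) t

/-- The points of `(-s, s)` at which the weighted orthonormal polynomials are bounded by `κ`. -/
def boundedSet (v : ℝ → ℝ≥0∞) (s : ℝ) (n : ℕ) (κ : ℝ) : Set ℝ :=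
  {t | t ∈ Ioo (-s) s ∧ v t ≠ 0 ∧ v t ≠ ∞ ∧
    (weight v t).toReal * ∑ k : Fin n, orthoPoly s k t ^ 2 ≤ κ}

variable {v : ℝ → ℝ≥0∞} {s : ℝ} {n : ℕ} {κ : ℝ}

theorem measurable_weight (hv : Measurable v) : Measurable (weight v) := hv.inv

theorem measurable_orthoPoly (s : ℝ) (k : ℕ) : Measurable (orthoPoly s k) :=
  (continuous_orthoPoly s k).measurable

theorem measurableSet_boundedSet (hv : Measurable v) : MeasurableSet (boundedSet v s n κ) := by
  have h1 : MeasurableSet {t | v t ≠ 0} := (hv (measurableSet_singleton 0)).compl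
  have h2 : MeasurableSet {t | v t ≠ ∞} := (hv (measurableSet_singleton ∞)).compl
  have h3 : Measurable fun t => (weight v t).toReal * ∑ k : Fin n, orthoPoly s k t ^ 2 :=
    (measurable_weight hv).ennreal_toReal.mul
      (Finset.measurable_sum _ fun k _ => (measurable_orthoPoly s k).pow_const 2)
  exact measurableSet_Ioo.inter (h1.inter (h2.inter (measurableSet_le h3 measurable_const)))

theorem measurable_sampleVec {A : Set ℝ} (hA : MeasurableSet A) (hv : Measurable v) :
    Measurable (sampleVec A v s n) :=
  measurable_pi_lambda _ fun k =>
    (((measurable_weight hv).ennreal_toReal.sqrt).mul (measurable_orthoPoly s k)).indicator hA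

theorem dotProduct_sampleVec_sq (A : Set ℝ) (c : Fin n → ℝ) (t : ℝ) :
    (c ⬝ᵥ sampleVec A v s n t) ^ 2 =
      A.indicator (fun t => (weight v t).toReal * (∑ k, c k * orthoPoly s k t) ^ 2) t := by
  by_cases ht : t ∈ A
  · simp only [dotProduct, sampleVec, indicator_of_mem ht]
    have : ∑ k : Fin n, c k * (√(weight v t).toReal * orthoPoly s k t) =
        √(weight v t).toReal * ∑ k : Fin n, c k * orthoPoly s k t := by
      rw [Finset.mul_sum]; exact Finset.sum_congr rfl fun k _ => by ring
    rw [this, mul_pow, Real.sq_sqrt ENNReal.toReal_nonneg]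
  · simp [dotProduct, sampleVec, indicator_of_notMem ht]

theorem sampleVec_dotProduct_self_le (hκ : 0 ≤ κ) (t : ℝ) :
    sampleVec (boundedSet v s n κ) v s n t ⬝ᵥ sampleVec (boundedSet v s n κ) v s n t ≤ κ := by
  by_cases ht : t ∈ boundedSet v s n κ
  · refine le_trans (le_of_eq ?_) ht.2.2.2
    simp only [dotProduct, sampleVec, indicator_of_mem ht, Finset.mul_sum]
    refine Finset.sum_congr rfl fun k _ => ?_
    have := Real.mul_self_sqrt (ENNReal.toReal_nonneg (a := weight v t))
    linear_combination orthoPoly s k t ^ 2 * this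
  · simpa [dotProduct, sampleVec, indicator_of_notMem ht] using hκ

/-- On the truncation set `w` cancels the density, so only the integral over the discarded part of
`(-s, s)` is lost; Cauchy–Schwarz bounds it by `η` times the squared norm of `c`. -/
theorem integral_sampleVec_sq_ge (hs0 : 0 < s) (hs : s ≤ 1) (hv : Measurable v)
    (hvt : ∀ᵐ t ∂unif, v t < ∞) {b η : ℝ}
    (hb : ∀ t ∈ Ioo (-s) s, ∑ k : Fin n, orthoPoly s k t ^ 2 ≤ b)
    (hη : b * unif.real (Ioo (-s) s \ boundedSet v s n κ) ≤ η) (c : Fin n → ℝ) :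
    (1 - η) * (c ⬝ᵥ c) ≤
      ∫ t, (c ⬝ᵥ sampleVec (boundedSet v s n κ) v s n t) ^ 2 ∂(unif.withDensity v) := by
  set A := boundedSet v s n κ with hAdef
  have hA : MeasurableSet A := measurableSet_boundedSet hv
  have hAΩ : A ⊆ Ioo (-s) s := fun t ht => ht.1
  set q : ℝ → ℝ := fun t => (∑ k : Fin n, c k * orthoPoly s k t) ^ 2 with hq
  have hqc : Continuous q := by
    have := continuous_orthoPoly s
    fun_prop
  have hcc : c ⬝ᵥ c = ∑ k, c k ^ 2 := by simp [dotProduct, sq]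
  have h1 : ∫ t, (c ⬝ᵥ sampleVec A v s n t) ^ 2 ∂(unif.withDensity v) = ∫ t in A, q t ∂unif := by
    rw [integral_withDensity_eq_integral_toReal_smul hv hvt, ← integral_indicator hA]
    refine integral_congr_ae (ae_of_all _ fun t => ?_)
    simp only
    rw [dotProduct_sampleVec_sq]
    by_cases ht : t ∈ A
    · rw [indicator_of_mem ht, indicator_of_mem ht, smul_eq_mul, ← mul_assoc, weight,
        ENNReal.toReal_inv, mul_inv_cancel₀ (ENNReal.toReal_ne_zero.2 ⟨ht.2.1, ht.2.2.1⟩), one_mul]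
    · rw [indicator_of_notMem ht, indicator_of_notMem ht, smul_zero]
  have h2 : ∫ t in Ioo (-s) s \ A, q t ∂unif = c ⬝ᵥ c - ∫ t in A, q t ∂unif := by
    rw [setIntegral_sdiff hA (integrable_unif_restrict hqc) hAΩ, integral_sum_orthoPoly_sq hs0 hs, hcc]
  have hc0 : 0 ≤ c ⬝ᵥ c := by rw [hcc]; positivity
  have h3 : ∫ t in Ioo (-s) s \ A, q t ∂unif ≤
      (c ⬝ᵥ c) * b * unif.real (Ioo (-s) s \ A) := by
    refine (le_abs_self _).trans ?_
    rw [← Real.norm_eq_abs]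
    refine norm_setIntegral_le_of_norm_le_const (measure_lt_top _ _) ?_
    intro t ht
    rw [Real.norm_eq_abs, abs_of_nonneg (sq_nonneg _)]
    refine (Finset.sum_mul_sq_le_sq_mul_sq _ _ _).trans ?_
    rw [hcc]
    exact mul_le_mul_of_nonneg_left (hb t ht.1) (by positivity)
  have h4 := mul_le_mul_of_nonneg_left hη hc0
  rw [h1]
  linarith

/-- The event that the sampled vectors do not determine a polynomial stably. -/
def unstableSet (v : ℝ → ℝ≥0∞) (s : ℝ) (n : ℕ) (κ : ℝ) (m : ℕ) : Set (Fin m → ℝ) :=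
  {x | ∃ a : Fin n → ℝ, a ⬝ᵥ a = 1 ∧
    ∑ i, (sampleVec (boundedSet v s n κ) v s n (x i) ⬝ᵥ a) ^ 2 ≤ m / 2}

theorem measure_unstableSet_le (hs0 : 0 < s) (hs : s ≤ 1) (hv : Measurable v)
    (hvt : ∀ᵐ t ∂unif, v t < ∞) [IsProbabilityMeasure (unif.withDensity v)] {b η : ℝ}
    (hb : ∀ t ∈ Ioo (-s) s, ∑ k : Fin n, orthoPoly s k t ^ 2 ≤ b)
    (hη : b * unif.real (Ioo (-s) s \ boundedSet v s n κ) ≤ η) (hη0 : 0 ≤ η) (hκ : 1 ≤ κ)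
    (m : ℕ) :
    sampleLaw m (unif.withDensity v) (unstableSet v s n κ m) ≤
      ENNReal.ofReal (n * Real.exp (-(m / (2 * κ) * (1 - η - Real.log 2)))) := by
  have hκ0 : 0 < κ := by linarith
  have h := measure_exists_sum_sq_lt_le (unif.withDensity v) hκ0
    (measurable_sampleVec (s := s) (n := n) (measurableSet_boundedSet hv) hv)
    (sampleVec_dotProduct_self_le hκ0.le) (β := 1 - η) (by linarith)
    (integral_sampleVec_sq_ge hs0 hs hv hvt hb hη) m (m / 2)
  refine h.trans (ENNReal.ofReal_le_ofReal ?_)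
  have h0 : 0 ≤ 1 - (1 - η) / (2 * κ) := by
    rw [sub_nonneg, div_le_one (by positivity)]; linarith
  have h1 : (1 - (1 - η) / (2 * κ)) ^ m ≤ Real.exp (-(m * ((1 - η) / (2 * κ)))) := by
    rw [← mul_neg, Real.exp_nat_mul]
    gcongr
    exact Real.one_sub_le_exp_neg _
  rw [mul_assoc]
  gcongr
  calc _ ≤ Real.exp (-(m * ((1 - η) / (2 * κ)))) * Real.exp (Real.log 2 / κ * (m / 2)) := by
        gcongr
    _ = _ := by rw [← Real.exp_add]; congr 1; field_simp; ring

end SampleVectors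

/-! ### Error bound on an event of probability at least `1 - ε`. -/

section Recovery

theorem continuous_of_mem_polySpace {n : ℕ} {p : ℝ → ℂ} (hp : p ∈ polySpace n) :
    Continuous p := by
  obtain ⟨q, -, rfl⟩ := hp
  exact q.continuous.comp Complex.continuous_ofReal

theorem memLp_of_mem_polySpace {n : ℕ} {p : ℝ → ℂ} (hp : p ∈ polySpace n) (q : ℝ≥0∞) :
    MemLp p q unif := by
  have hc := continuous_of_mem_polySpace hp
  obtain ⟨C, hC⟩ := isCompact_Icc.exists_bound_of_continuousOn (s := Icc (-1 : ℝ) 1)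
    hc.continuousOn
  refine MemLp.of_bound hc.aestronglyMeasurable C (Measure.ae_smul_measure ?_ _)
  filter_upwards [ae_restrict_mem measurableSet_Ioo] with t ht
  exact hC t (Ioo_subset_Icc_self ht)

theorem exists_recovery_event {v v' : ℝ → ℝ≥0∞} {s r ε κ : ℝ} {n m : ℕ} (hs0 : 0 < s)
    (hr : 0 ≤ r) (hε0 : 0 < ε) (hm : 0 < m) (hvm : AEMeasurable v unif)
    [IsProbabilityMeasure (unif.withDensity v)] (hvv' : ∀ᵐ t ∂(unif.withDensity v), v t = v' t)
    (hK : ∀ x : ℝ, |x| ≤ 1 → ∑ k : Fin n, orthoPoly s k x ^ 2 ≤ 2 * (n * r) ^ 2)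
    (hbad : sampleLaw m (unif.withDensity v) (unstableSet v' s n κ m) ≤ ENNReal.ofReal (ε / 3))
    {f fn : ℝ → ℂ} (hf : MemLp f 2 unif) (hfn : fn ∈ polySpace n) :
    ∃ E : Set (Fin m → ℝ), MeasurableSet E ∧
      ENNReal.ofReal (1 - ε) ≤ sampleLaw m (unif.withDensity v) E ∧
      ∀ x ∈ E, (∀ i, weight v (x i) ≠ ∞) ∧ ∀ e : EuclideanSpace ℂ (Fin m), ∀ h : ℝ → ℂ,
        IsWLSMinimizer (polySpace n) (weight v) x (fun i => f (x i) + e i) h →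
        ∀ t : ℝ, |t| ≤ 1 → ‖(h - fn) t‖ ≤ 8 * r * n / √ε *
          ((eLpNorm (f - fn) 2 unif).toReal + ‖e‖) := by
  set μ := unif.withDensity v with hμ
  have hg := hf.sub (memLp_of_mem_polySpace hfn 2)
  set G := (eLpNorm (f - fn) 2 unif).toReal with hG
  have hGe : ENNReal.ofReal G = eLpNorm (f - fn) 2 unif := ENNReal.ofReal_toReal hg.2.ne
  have hδ0 : ENNReal.ofReal (ε / 3) ≠ 0 := by simpa using hε0
  have hac : μ ≪ unif := withDensity_absolutelyContinuous _ _
  have hwm : AEMeasurable (weight v) μ := hvm.inv.mono_ac hac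
  set F : ℝ → ℝ≥0∞ := fun t => ‖(f - fn) t‖ₑ ^ 2 with hF
  have hFm : AEMeasurable F unif := hg.1.enorm.pow_const 2
  have hb4 : sampleLaw m μ {x | m * eLpNorm (f - fn) 2 unif ^ 2 / ENNReal.ofReal (ε / 3) <
      ∑ i, weight v (x i) * F (x i)} ≤ ENNReal.ofReal (ε / 3) := by
    refine measure_sum_gt_le μ m (F := fun t => weight v t * F t)
      (hwm.mul (hFm.mono_ac hac)) ?_ ?_ hδ0 ENNReal.ofReal_ne_top
    · rw [eLpNorm_two_sq]
      exact lintegral_weight_mul_le hvm hFm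
    · exact ENNReal.pow_ne_top hg.2.ne
  have hb5 : sampleLaw m μ {x | m * 1 / ENNReal.ofReal (ε / 3) < ∑ i, weight v (x i)} ≤
      ENNReal.ofReal (ε / 3) := by
    refine measure_sum_gt_le μ m hwm ?_ ENNReal.one_ne_top hδ0 ENNReal.ofReal_ne_top
    have := lintegral_weight_mul_le (F := fun _ => 1) hvm aemeasurable_const
    simpa using this
  have hv0 : ∀ᵐ t ∂μ, v t ≠ 0 := (ae_withDensity_iff' hvm).2 (ae_of_all _ fun t h => h)
  have hb1 : sampleLaw m μ {x | ¬ ∀ i, v (x i) = v' (x i) ∧ v (x i) ≠ 0} = 0 :=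
    ae_iff.1 (ae_sampleLaw_of_ae μ m (hvv'.and hv0))
  set B4 := {x : Fin m → ℝ | m * eLpNorm (f - fn) 2 unif ^ 2 / ENNReal.ofReal (ε / 3) <
      ∑ i, weight v (x i) * F (x i)} with hB4
  set B5 := {x : Fin m → ℝ | m * 1 / ENNReal.ofReal (ε / 3) < ∑ i, weight v (x i)} with hB5
  set B1 := {x : Fin m → ℝ | ¬ ∀ i, v (x i) = v' (x i) ∧ v (x i) ≠ 0} with hB1
  set B := unstableSet v' s n κ m ∪ B4 ∪ B5 ∪ B1 with hB
  have : IsProbabilityMeasure (sampleLaw m μ) := by unfold sampleLaw; infer_instance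
  have hBle : sampleLaw m μ B ≤ ENNReal.ofReal ε := by
    calc sampleLaw m μ B ≤ sampleLaw m μ (unstableSet v' s n κ m) + sampleLaw m μ B4 +
          sampleLaw m μ B5 + sampleLaw m μ B1 :=
          (measure_union_le _ _).trans (add_le_add_left ((measure_union_le _ _).trans
            (add_le_add_left (measure_union_le _ _) _)) _)
      _ ≤ ENNReal.ofReal (ε / 3) + ENNReal.ofReal (ε / 3) + ENNReal.ofReal (ε / 3) + 0 := by
          gcongr; exact hb1.le
      _ = ENNReal.ofReal ε := by
          rw [add_zero, ← ENNReal.ofReal_add (by positivity) (by positivity),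
            ← ENNReal.ofReal_add (by positivity) (by positivity)]
          congr 1; ring
  -- A measurable hull of `B` has the same measure, so no measurability of the unstable set is
  -- needed.
  refine ⟨(toMeasurable (sampleLaw m μ) B)ᶜ, (measurableSet_toMeasurable _ _).compl, ?_, ?_⟩
  · rw [prob_compl_eq_one_sub (measurableSet_toMeasurable _ _), measure_toMeasurable,
      ENNReal.ofReal_sub _ hε0.le, ENNReal.ofReal_one]
    gcongr
  intro x hx
  have hxB : x ∉ B := fun h => hx (subset_toMeasurable _ _ h)
  simp only [hB, mem_union, not_or] at hxB
  obtain ⟨⟨⟨hx3, hx4⟩, hx5⟩, hx1⟩ := hxB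
  simp only [hB1, mem_ofPred_eq, not_not] at hx1
  simp only [hB4, hB5, mem_ofPred_eq, not_lt] at hx4 hx5
  have hwt : ∀ i, weight v (x i) ≠ ∞ := fun i => ENNReal.inv_ne_top.2 (hx1 i).2
  refine ⟨hwt, fun e h hh t ht => ?_⟩
  have hm' : (0 : ℝ) < m := by exact_mod_cast hm
  set R : ℝ := m / (ε / 3) with hR
  have hR0 : 0 ≤ R := by positivity
  have hwR : ∀ i, (weight v (x i)).toReal ≤ R := by
    intro i
    refine ENNReal.toReal_le_of_le_ofReal hR0 ?_
    rw [hR, ENNReal.ofReal_div_of_pos (by positivity), ENNReal.ofReal_natCast]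
    rw [mul_one] at hx5
    exact (Finset.single_le_sum (f := fun i => weight v (x i)) (fun _ _ => bot_le)
      (Finset.mem_univ i)).trans hx5
  have hfR : ∑ i, (weight v (x i)).toReal * ‖f (x i) - fn (x i)‖ ^ 2 ≤ R * G ^ 2 := by
    rw [← ENNReal.ofReal_le_ofReal_iff (by positivity),
      ENNReal.ofReal_sum_of_nonneg (fun i _ => by positivity)]
    refine le_trans (le_of_eq ?_) (hx4.trans (le_of_eq ?_))
    · refine Finset.sum_congr rfl fun i _ => ?_
      rw [ENNReal.ofReal_mul ENNReal.toReal_nonneg, ENNReal.ofReal_toReal (hwt i),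
        ENNReal.ofReal_pow (norm_nonneg _), ofReal_norm]
      rfl
    · rw [ENNReal.ofReal_mul hR0, hR, ENNReal.ofReal_div_of_pos (show 0 < ε / 3 by positivity),
        ENNReal.ofReal_natCast, ENNReal.ofReal_pow ENNReal.toReal_nonneg, hGe,
        ENNReal.mul_div_right_comm]
  have hvec := norm_weightedVec_sub_le_of_isWLSMinimizer hwt hfn e hh ENNReal.toReal_nonneg hwR hfR
  obtain ⟨a, ha⟩ := (mem_polySpace_iff hs0).1 (Submodule.sub_mem _ hh.1 hfn)
  have hlow := mul_sum_norm_sq_le_of_real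
    (b := fun i => sampleVec (boundedSet v' s n κ) v' s n (x i)) (t := m / 2) (by
      intro a ha1
      by_contra hcon
      refine hx3 ⟨a, ?_, ?_⟩
      · simpa [dotProduct, sq] using ha1
      · simpa [dotProduct] using (not_le.1 hcon).le) a
  have hup : ∑ i, ‖∑ k, (sampleVec (boundedSet v' s n κ) v' s n (x i) k : ℂ) * a k‖ ^ 2 ≤
      ‖weightedVec (fun i => (weight v (x i)).toReal) ((h - fn) ∘ x)‖ ^ 2 := by
    rw [norm_weightedVec_sq (fun i => ENNReal.toReal_nonneg)]
    refine Finset.sum_le_sum fun i _ => ?_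
    have hw' : weight v' (x i) = weight v (x i) := by simp only [weight, (hx1 i).1]
    by_cases hxi : x i ∈ boundedSet v' s n κ
    · simp only [sampleVec, indicator_of_mem hxi, hw', Function.comp_apply]
      rw [ha]
      have h1 : ∑ k : Fin n, ((√(weight v (x i)).toReal * orthoPoly s k (x i) : ℝ) : ℂ) * a k =
          ((√(weight v (x i)).toReal : ℝ) : ℂ) * ∑ k, a k * (orthoPoly s k (x i) : ℂ) := by
        rw [Finset.mul_sum]
        exact Finset.sum_congr rfl fun k _ => by push_cast; ring
      rw [h1, norm_mul, mul_pow, Complex.norm_real, Real.norm_eq_abs, sq_abs,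
        Real.sq_sqrt ENNReal.toReal_nonneg]
    · simp only [sampleVec, indicator_of_notMem hxi]
      simp only [Complex.ofReal_zero, zero_mul, Finset.sum_const_zero, norm_zero]
      rw [zero_pow two_ne_zero]
      exact mul_nonneg ENNReal.toReal_nonneg (sq_nonneg _)
  set S := ∑ k, ‖a k‖ ^ 2 with hS
  have hS0 : 0 ≤ S := by positivity
  -- Stability gives `(m/2)S` from below and the residual bound `4R(G + ‖e‖)²` from above; with `R =
  -- 3m/ε` the constant is `2·4·3`.
  have hSle : S ≤ 24 / ε * (G + ‖e‖) ^ 2 := by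
    have h1 : m / 2 * S ≤ (2 * (√R * (G + ‖e‖))) ^ 2 :=
      hlow.trans (hup.trans (pow_le_pow_left₀ (norm_nonneg _) hvec 2))
    have h2 : (2 * (√R * (G + ‖e‖))) ^ 2 = m / 2 * (24 / ε * (G + ‖e‖) ^ 2) := by
      rw [mul_pow, mul_pow, Real.sq_sqrt hR0, hR]; field_simp; ring
    rw [h2] at h1
    exact le_of_mul_le_mul_left h1 (by positivity)
  have hpt : ‖(h - fn) t‖ ^ 2 ≤ S * (2 * (n * r) ^ 2) := by
    rw [ha]
    have h1 : ‖∑ k, a k * (orthoPoly s k t : ℂ)‖ ≤ ∑ k, ‖a k‖ * |orthoPoly s k t| := by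
      refine (norm_sum_le _ _).trans (le_of_eq (Finset.sum_congr rfl fun k _ => ?_))
      rw [norm_mul, Complex.norm_real, Real.norm_eq_abs]
    calc _ ≤ (∑ k, ‖a k‖ * |orthoPoly s k t|) ^ 2 := by gcongr
      _ ≤ S * ∑ k : Fin n, |orthoPoly s k t| ^ 2 := Finset.sum_mul_sq_le_sq_mul_sq _ _ _
      _ ≤ _ := by
        simp only [sq_abs]
        exact mul_le_mul_of_nonneg_left (hK t ht) hS0
  have hG0 : 0 ≤ G := ENNReal.toReal_nonneg
  refine (pow_le_pow_iff_left₀ (norm_nonneg _) (by positivity) two_ne_zero).1 (hpt.trans ?_)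
  -- The resulting `24·2 = 48` is rounded up to `64 = 8²`.
  calc S * (2 * (n * r) ^ 2) ≤ 24 / ε * (G + ‖e‖) ^ 2 * (2 * (n * r) ^ 2) := by gcongr
    _ ≤ 64 * (n * r) ^ 2 / ε * (G + ‖e‖) ^ 2 := by
        rw [show 24 / ε * (G + ‖e‖) ^ 2 * (2 * (n * r) ^ 2) =
          48 * (n * r) ^ 2 / ε * (G + ‖e‖) ^ 2 by ring]
        gcongr
        norm_num
    _ = _ := by
        rw [mul_pow (_ / _), div_pow, Real.sq_sqrt hε0.le]; ring

end Recovery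

/-! ### Expected cost and the size of `sup w·K`. -/

section Cost

theorem expectedCost_le {v : ℝ → ℝ≥0∞} (hvm : AEMeasurable v unif)
    [IsProbabilityMeasure (unif.withDensity v)] {c : ℝ → ℝ} (hcm : AEMeasurable c unif) (m : ℕ) :
    expectedCost m (unif.withDensity v) c ≤
      m * (2⁻¹ * ∫⁻ x in (unif.withDensity v).support ∩ Ioo (-1 : ℝ) 1,
        ENNReal.ofReal (c x) / weight v x) := by
  set μ := unif.withDensity v with hμ
  have hc' : AEMeasurable (fun t => ENNReal.ofReal (c t)) unif := hcm.ennreal_ofReal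
  have hS : MeasurableSet μ.support := Measure.isClosed_support.measurableSet
  rw [expectedCost, lintegral_sampleLaw_sum μ m (F := fun t => ENNReal.ofReal (c t))
    (hc'.mono_ac (withDensity_absolutelyContinuous _ _))]
  gcongr
  have key : ∀ S : Set ℝ, MeasurableSet S → ∫⁻ t in S, ENNReal.ofReal (c t) ∂μ =
      2⁻¹ * ∫⁻ t in S ∩ Ioo (-1 : ℝ) 1, ENNReal.ofReal (c t) / weight v t := by
    intro S hS
    rw [hμ, restrict_withDensity hS, lintegral_withDensity_eq_lintegral_mul₀
      (hvm.mono_measure Measure.restrict_le_self) (hc'.mono_measure Measure.restrict_le_self),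
      unif, Measure.restrict_smul, lintegral_smul_measure, Measure.restrict_restrict hS,
      smul_eq_mul]
    congr 1
    refine lintegral_congr fun t => ?_
    simp only [Pi.mul_apply, weight, div_eq_mul_inv, inv_inv]
    rw [mul_comm]
  rw [← key _ hS, Measure.restrict_eq_self_of_ae_mem (s := μ.support) (μ := μ) Measure.support_mem_ae]

/-- Orthonormality makes `∫ ∑ L_k²` equal to `n`, while the integrand is at most `vκ` and `v` has
total mass one. This yields both `κ ≥ 1` and `m ≥ n` later. -/
theorem natCast_le_iSup_weight_mul_christoffel {v : ℝ → ℝ≥0∞} (hvm : AEMeasurable v unif)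
    [IsProbabilityMeasure (unif.withDensity v)] {s : ℝ} (hs0 : 0 < s) (hs : s ≤ 1)
    (hv : ∀ᵐ x ∂(unif.restrict (Ioo (-s) s)), 0 < v x) (hvt : ∀ᵐ x ∂unif, v x < ∞) (n : ℕ) :
    (n : ℝ≥0∞) ≤ ⨆ x ∈ Ioo (-s) s, weight v x *
      christoffel (polySpace n) (unif.restrict (Ioo (-s) s)) x := by
  set κ := ⨆ x ∈ Ioo (-s) s, weight v x *
    christoffel (polySpace n) (unif.restrict (Ioo (-s) s)) x with hκ
  have h1 : (n : ℝ≥0∞) =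
      ∫⁻ x, ENNReal.ofReal (∑ k : Fin n, orthoPoly s k x ^ 2) ∂(unif.restrict (Ioo (-s) s)) := by
    have hi : ∀ k : ℕ, Integrable (fun x => orthoPoly s k x ^ 2) (unif.restrict (Ioo (-s) s)) :=
      fun k => integrable_unif_restrict ((continuous_orthoPoly s k).pow 2)
    rw [← ofReal_integral_eq_lintegral_ofReal (integrable_finsetSum _ fun (k : Fin n) _ => hi k)
      (ae_of_all _ fun x => Finset.sum_nonneg fun k _ => sq_nonneg _),
      integral_finsetSum _ fun (k : Fin n) _ => hi k]
    simp only [sq, integral_orthoPoly_mul hs0 hs]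
    simp
  have hle : ∀ᵐ x ∂(unif.restrict (Ioo (-s) s)),
      ENNReal.ofReal (∑ k : Fin n, orthoPoly s k x ^ 2) ≤ v x * κ := by
    filter_upwards [hv, ae_restrict_of_ae hvt, ae_restrict_mem measurableSet_Ioo] with x h0 ht hx
    refine (ofReal_sum_sq_le_christoffel hs0 hs x).trans ?_
    have h2 : weight v x * christoffel (polySpace n) (unif.restrict (Ioo (-s) s)) x ≤ κ :=
      le_iSup₂_of_le (f := fun x (_ : x ∈ Ioo (-s) s) => weight v x *
        christoffel (polySpace n) (unif.restrict (Ioo (-s) s)) x) x hx le_rfl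
    calc _ = v x * (weight v x *
          christoffel (polySpace n) (unif.restrict (Ioo (-s) s)) x) := by
          rw [← mul_assoc, weight, ENNReal.mul_inv_cancel h0.ne' ht.ne, one_mul]
      _ ≤ _ := by gcongr
  rw [h1]
  calc _ ≤ ∫⁻ x, v x * κ ∂(unif.restrict (Ioo (-s) s)) := lintegral_mono_ae hle
    _ = (∫⁻ x, v x ∂(unif.restrict (Ioo (-s) s))) * κ :=
        lintegral_mul_const'' _ (hvm.mono_measure Measure.restrict_le_self)
    _ ≤ 1 * κ := by
        gcongr
        calc _ ≤ ∫⁻ x, v x ∂unif := lintegral_mono' Measure.restrict_le_self le_rfl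
          _ = unif.withDensity v univ := by
            rw [withDensity_apply _ MeasurableSet.univ, Measure.restrict_univ]
          _ ≤ 1 := prob_le_one
    _ = κ := one_mul _

theorem toReal_weight_mul_le {v : ℝ → ℝ≥0∞} {s : ℝ} (hs0 : 0 < s) (hs : s ≤ 1) {n : ℕ}
    {κ : ℝ≥0∞} (hκ : κ ≠ ∞) {x : ℝ}
    (h : weight v x * christoffel (polySpace n) (unif.restrict (Ioo (-s) s)) x ≤ κ) :
    (weight v x).toReal * ∑ k : Fin n, orthoPoly s k x ^ 2 ≤ κ.toReal := by
  have h0 : 0 ≤ ∑ k : Fin n, orthoPoly s k x ^ 2 := by positivity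
  have h1 : weight v x * ENNReal.ofReal (∑ k : Fin n, orthoPoly s k x ^ 2) ≤ κ :=
    le_trans (by gcongr; exact ofReal_sum_sq_le_christoffel hs0 hs x) h
  have h2 := ENNReal.toReal_mono hκ h1
  rwa [ENNReal.toReal_mul, ENNReal.toReal_ofReal h0] at h2

end Cost

/-! ### Choice of the number of samples. -/

section SampleSize

variable {v v' : ℝ → ℝ≥0∞} {s : ℝ} {n : ℕ}

/-- With `κ` large enough, the weights exceed `κ` only on a small set. -/
theorem exists_measure_diff_boundedSet_le (hv' : Measurable v')
    (hpos : ∀ᵐ x ∂(unif.restrict (Ioo (-s) s)), v' x ≠ 0) (hvt : ∀ᵐ x ∂unif, v' x < ∞)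
    (b : ℝ) {η : ℝ} (hη : 0 < η) :
    ∃ κ : ℝ, 1 ≤ κ ∧ b * unif.real (Ioo (-s) s \ boundedSet v' s n κ) ≤ η := by
  have hlim := tendsto_measure_iInter_atTop (μ := unif)
    (s := fun j : ℕ => Ioo (-s) s \ boundedSet v' s n j)
    (fun j => (measurableSet_Ioo.diff (measurableSet_boundedSet hv')).nullMeasurableSet)
    (fun i j hij x hx => ⟨hx.1, fun h => hx.2 ⟨h.1, h.2.1, h.2.2.1,
      h.2.2.2.trans (by exact_mod_cast hij)⟩⟩)
    ⟨0, measure_ne_top _ _⟩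
  have h0 : unif (⋂ j : ℕ, Ioo (-s) s \ boundedSet v' s n j) = 0 := by
    have ha := ae_iff.1 (((ae_restrict_iff' measurableSet_Ioo).1 hpos).and hvt)
    refine measure_mono_null (fun x hx => ?_) ha
    simp only [mem_ofPred_eq, not_and, mem_iInter] at hx ⊢
    intro h1 h2
    obtain ⟨j, hj⟩ := exists_nat_ge ((weight v' x).toReal * ∑ k : Fin n, orthoPoly s k x ^ 2)
    exact (hx j).2 ⟨(hx j).1, h1 (hx j).1, h2.ne, hj⟩
  rw [h0] at hlim
  have h1 := (ENNReal.tendsto_toReal ENNReal.zero_ne_top).comp hlim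
  have h2 := (h1.const_mul b)
  simp only [ENNReal.toReal_zero, mul_zero] at h2
  obtain ⟨j, hj, hj1⟩ := ((h2.eventually (gt_mem_nhds hη)).and
    (Filter.eventually_ge_atTop 1)).exists
  exact ⟨j, by exact_mod_cast hj1, hj.le⟩

theorem natFloor_sampleSize_spec {κ ε : ℝ} (hn : n ≠ 0) (hκ : n ≤ κ) (hε0 : 0 < ε)
    (hε1 : ε < 1) :
    n ≤ ⌊16 * κ * Real.log (3 * n / ε)⌋₊ ∧
      n * Real.exp (-(⌊16 * κ * Real.log (3 * n / ε)⌋₊ / (2 * κ) * (1 - 0 - Real.log 2))) ≤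
        ε / 3 := by
  have hn1 : (1 : ℝ) ≤ n := by exact_mod_cast Nat.one_le_iff_ne_zero.2 hn
  have hκ1 : 1 ≤ κ := hn1.trans hκ
  have h3 : 3 ≤ 3 * n / ε := by
    rw [le_div_iff₀ hε0]; nlinarith
  set l := Real.log (3 * n / ε) with hl
  have hl1 : 1 ≤ l := by
    rw [hl, Real.le_log_iff_exp_le (by linarith)]
    exact (Real.exp_one_lt_d9.le.trans (by norm_num)).trans h3
  have hκl : 1 ≤ κ * l := by nlinarith
  have hfloor := Nat.sub_one_lt_floor (16 * κ * l)
  set m := ⌊16 * κ * l⌋₊ with hm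
  refine ⟨Nat.le_floor (by nlinarith), ?_⟩
  have hlog2 := Real.log_two_lt_d9
  -- The floor, needed to keep `m ≤ 16κl`, loses less than `1 ≤ κl`, so `m ≥ 15κl`; then `1 - log 2
  -- ≥ 2/15` suffices.
  have hml : l ≤ m / (2 * κ) * (1 - 0 - Real.log 2) := by
    have h1 : 15 / 2 * l ≤ m / (2 * κ) := by
      rw [le_div_iff₀ (by positivity)]; nlinarith
    have h2 : 2 / 15 ≤ 1 - 0 - Real.log 2 := by linarith
    calc l = 15 / 2 * l * (2 / 15) := by ring
      _ ≤ _ := mul_le_mul h1 h2 (by norm_num) (by positivity)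
  calc n * Real.exp (-(m / (2 * κ) * (1 - 0 - Real.log 2))) ≤ n * Real.exp (-l) := by gcongr
    _ = ε / 3 := by
      rw [hl, Real.exp_neg, Real.exp_log (by linarith)]
      have : (n : ℝ) ≠ 0 := by positivity
      field_simp

theorem exists_nat_mul_exp_le {κ ε : ℝ} (hκ : 1 ≤ κ) (hε0 : 0 < ε) (n : ℕ) :
    ∃ m : ℕ, n ≤ m ∧ n * Real.exp (-(m / (2 * κ) * (1 - 1 / 4 - Real.log 2))) ≤ ε / 3 := by
  have hlog2 := Real.log_two_lt_d9
  have hc : 0 < (1 - 1 / 4 - Real.log 2) / (2 * κ) := div_pos (by linarith) (by linarith)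
  have h1 : Filter.Tendsto
      (fun m : ℕ => n * Real.exp (-(m * ((1 - 1 / 4 - Real.log 2) / (2 * κ))))) Filter.atTop
      (nhds (n * 0)) :=
    (Real.tendsto_exp_neg_atTop_nhds_zero.comp
      (tendsto_natCast_atTop_atTop.atTop_mul_const hc)).const_mul _
  rw [mul_zero] at h1
  obtain ⟨m, hm, hnm⟩ := ((h1.eventually (gt_mem_nhds (show 0 < ε / 3 by positivity))).and
    (Filter.eventually_ge_atTop n)).exists
  refine ⟨m, hnm, le_trans (le_of_eq ?_) hm.le⟩
  congr 3
  ring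

/-- A stable number of samples, bounded in terms of the weighted Christoffel function. -/
theorem exists_sampleSize {r ε : ℝ} (hn : n ≠ 0) (hs0 : 0 < s) (hs : s ≤ 1)
    (hvm : AEMeasurable v unif) [IsProbabilityMeasure (unif.withDensity v)]
    (hv : ∀ᵐ x ∂(unif.restrict (Ioo (-s) s)), 0 < v x) (hv' : Measurable v')
    (hvv' : v =ᵐ[unif] v') (hε0 : 0 < ε) (hε1 : ε < 1)
    (hK : ∀ x : ℝ, |x| ≤ 1 → ∑ k : Fin n, orthoPoly s k x ^ 2 ≤ 2 * (n * r) ^ 2) :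
    ∃ (m : ℕ) (κ : ℝ), n ≤ m ∧
      (m : ℝ≥0∞) ≤ 16 * (⨆ x ∈ Ioo (-s) s, weight v x *
        christoffel (polySpace n) (unif.restrict (Ioo (-s) s)) x) *
        ENNReal.ofReal (Real.log (3 * n / ε)) ∧
      sampleLaw m (unif.withDensity v) (unstableSet v' s n κ m) ≤ ENNReal.ofReal (ε / 3) := by
  have hwd : unif.withDensity v = unif.withDensity v' := withDensity_congr_ae hvv'
  have hvint : ∫⁻ x, v x ∂unif ≠ ∞ := by
    have h1 : ∫⁻ x, v x ∂unif = unif.withDensity v univ := by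
      rw [withDensity_apply _ MeasurableSet.univ, Measure.restrict_univ]
    rw [h1]; exact measure_ne_top _ _
  have hvt : ∀ᵐ x ∂unif, v x < ∞ := ae_lt_top' hvm hvint
  have hvt' : ∀ᵐ x ∂unif, v' x < ∞ := by
    filter_upwards [hvt, hvv'] with x h1 h2
    rwa [← h2]
  have hpos' : ∀ᵐ x ∂(unif.restrict (Ioo (-s) s)), v' x ≠ 0 := by
    filter_upwards [hv, ae_restrict_of_ae hvv'] with x h1 h2
    rw [← h2]; exact h1.ne'
  have hb : ∀ x ∈ Ioo (-s) s, ∑ k : Fin n, orthoPoly s k x ^ 2 ≤ 2 * (n * r) ^ 2 :=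
    fun x hx => hK x (abs_le.2 ⟨by linarith [hx.1], by linarith [hx.2]⟩)
  have hnκ := natCast_le_iSup_weight_mul_christoffel hvm hs0 hs hv hvt n
  set K := ⨆ x ∈ Ioo (-s) s, weight v x *
    christoffel (polySpace n) (unif.restrict (Ioo (-s) s)) x with hKdef
  have hn1 : (1 : ℝ) ≤ n := by exact_mod_cast Nat.one_le_iff_ne_zero.2 hn
  have : IsProbabilityMeasure (unif.withDensity v') := hwd ▸ inferInstance
  rw [hwd]
  have hlog : 0 < Real.log (3 * n / ε) := by
    apply Real.log_pos
    rw [lt_div_iff₀ hε0]; nlinarith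
  rcases eq_or_ne K ∞ with hKt | hKt
  -- With an infinite supremum the bound on `m` is void. The loss `η = 1/4` is admissible because `1
  -- - 1/4 - log 2 > 0`.
  · obtain ⟨κ, hκ1, hκ⟩ := exists_measure_diff_boundedSet_le (n := n) hv' hpos' hvt'
      (2 * (n * r) ^ 2) (show (0 : ℝ) < 1 / 4 by norm_num)
    obtain ⟨m, hnm, hm⟩ := exists_nat_mul_exp_le hκ1 hε0 n
    refine ⟨m, κ, hnm, ?_, ?_⟩
    · rw [hKt, ENNReal.mul_top (by norm_num), ENNReal.top_mul (by simpa using hlog)]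
      exact le_top
    · exact (measure_unstableSet_le hs0 hs hv' hvt' hb hκ (by norm_num) hκ1 m).trans
        (ENNReal.ofReal_le_ofReal hm)
  · have hnκ' : (n : ℝ) ≤ K.toReal := by
      simpa using ENNReal.toReal_mono hKt hnκ
    obtain ⟨hnm, hm⟩ := natFloor_sampleSize_spec hn hnκ' hε0 hε1
    refine ⟨_, K.toReal, hnm, ?_, ?_⟩
    · rw [← ENNReal.ofReal_natCast]
      refine (ENNReal.ofReal_le_ofReal (Nat.floor_le (by positivity))).trans (le_of_eq ?_)
      rw [ENNReal.ofReal_mul (by positivity), ENNReal.ofReal_mul (by positivity),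
        ENNReal.ofReal_toReal hKt]
      simp
    · have h0 : unif (Ioo (-s) s \ boundedSet v' s n K.toReal) = 0 := by
        have ha := ae_iff.1 ((((ae_restrict_iff' measurableSet_Ioo).1 hpos').and hvt').and hvv')
        refine measure_mono_null (fun x hx => ?_) ha
        simp only [mem_ofPred_eq]
        rintro ⟨⟨h1, h2⟩, h3⟩
        refine hx.2 ⟨hx.1, h1 hx.1, h2.ne, ?_⟩
        refine toReal_weight_mul_le hs0 hs hKt ?_
        have h4 : weight v' x = weight v x := by simp only [weight, h3]
        rw [h4]
        exact le_iSup₂_of_le (f := fun x (_ : x ∈ Ioo (-s) s) => weight v x *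
          christoffel (polySpace n) (unif.restrict (Ioo (-s) s)) x) x hx.1 le_rfl
      refine (measure_unstableSet_le hs0 hs hv' hvt' hb (η := 0) ?_ le_rfl
        (hn1.trans hnκ') _).trans (ENNReal.ofReal_le_ofReal hm)
      rw [measureReal_def, h0]; simp

end SampleSize

end CostSampling

/-! ### Assembly of the theorem. -/

theorem mainTheorem5
    (r : ℝ) (hr : 1 < r)
    (n : ℕ) (hn : Real.log r / Real.log (1 + Real.sqrt 8) ≤ (n : ℝ))
    (σ : ℝ) (hσ0 : 0 ≤ σ) (hσ : σ ≤ (r ^ (1 / (n : ℝ)) - 1) ^ 2 / 16)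
    (c : ℝ → ℝ) (hcm : AEMeasurable c CostSampling.unif)
    (hc : ∀ x ∈ Ioo (-1 : ℝ) 1, 0 < c x)
    (μ : Measure ℝ) [IsProbabilityMeasure μ]
    (v : ℝ → ℝ≥0∞) (hvm : AEMeasurable v CostSampling.unif)
    (hμ : μ = CostSampling.unif.withDensity v)
    (hv : ∀ᵐ x ∂(CostSampling.unif.restrict (Ioo (-(1 - σ)) (1 - σ))), 0 < v x)
    (ε : ℝ) (hε0 : 0 < ε) (hε1 : ε < 1) :
    ∃ m : ℕ, n ≤ m ∧
      CostSampling.expectedCost m μ c ≤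
        8 * (∫⁻ x in μ.support ∩ Ioo (-1 : ℝ) 1,
              ENNReal.ofReal (c x) / CostSampling.weight v x)
          * (⨆ x ∈ Ioo (-(1 - σ)) (1 - σ),
              CostSampling.weight v x *
                CostSampling.christoffel (CostSampling.polySpace n)
                  (CostSampling.unif.restrict (Ioo (-(1 - σ)) (1 - σ))) x)
          * ENNReal.ofReal (Real.log (3 * n / ε)) ∧
      ∀ f : ℝ → ℂ, MemLp f 2 CostSampling.unif →
      ∀ fn : ℝ → ℂ,
        CostSampling.IsBestApprox (CostSampling.polySpace n) CostSampling.unif f fn →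
        ∃ E : Set (Fin m → ℝ), MeasurableSet E ∧
          ENNReal.ofReal (1 - ε) ≤ CostSampling.sampleLaw m μ E ∧
          ∀ x ∈ E, ∀ e : EuclideanSpace ℂ (Fin m),
            (∃ fhat : ℝ → ℂ,
              CostSampling.IsWLSMinimizer (CostSampling.polySpace n) (CostSampling.weight v)
                x (fun i => f (x i) + e i) fhat) ∧
            ∀ fhat : ℝ → ℂ,
              CostSampling.IsWLSMinimizer (CostSampling.polySpace n) (CostSampling.weight v)
                x (fun i => f (x i) + e i) fhat →
              eLpNorm (f - fhat) 2 CostSampling.unif ≤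
                  eLpNorm (f - fn) 2 CostSampling.unif +
                    ENNReal.ofReal (8 * r * n / Real.sqrt ε) *
                      (eLpNorm (f - fn) 2 CostSampling.unif + ‖e‖ₑ) ∧
              eLpNorm (f - fhat) ∞ CostSampling.unif ≤
                  eLpNorm (f - fn) ∞ CostSampling.unif +
                    ENNReal.ofReal (8 * r * n / Real.sqrt ε) *
                      (eLpNorm (f - fn) 2 CostSampling.unif + ‖e‖ₑ) := by
  obtain ⟨hn0, hs2, hs⟩ := CostSampling.domain_shrink_bounds hr hn hσ
  have hs0 : 0 < 1 - σ := by linarith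
  have hs1 : 1 - σ ≤ 1 := by linarith
  subst hμ
  have hvv' := hvm.ae_eq_mk
  have hv' := hvm.measurable_mk
  set v' := hvm.mk v
  have hK : ∀ x : ℝ, |x| ≤ 1 →
      ∑ k : Fin n, CostSampling.orthoPoly (1 - σ) k x ^ 2 ≤ 2 * (n * r) ^ 2 :=
    fun x hx => CostSampling.sum_orthoPoly_sq_le hn0 hr hs2 hs hx
  obtain ⟨m, κ, hnm, hmK, hbad⟩ :=
    CostSampling.exists_sampleSize hn0 hs0 hs1 hvm hv hv' hvv' hε0 hε1 hK
  refine ⟨m, hnm, ?_, fun f hf fn hfn => ?_⟩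
  · refine (CostSampling.expectedCost_le hvm hcm m).trans ?_
    set I := ∫⁻ x in (CostSampling.unif.withDensity v).support ∩ Ioo (-1 : ℝ) 1,
      ENNReal.ofReal (c x) / CostSampling.weight v x
    have h2 : (16 : ℝ≥0∞) * 2⁻¹ = 8 := by
      rw [show (16 : ℝ≥0∞) = 8 * 2 by norm_num, mul_assoc,
        ENNReal.mul_inv_cancel two_ne_zero ENNReal.ofNat_ne_top, mul_one]
    refine (mul_le_mul_left hmK _).trans (le_of_eq ?_)
    rw [← h2]
    ring
  · obtain ⟨E, hE, hEm, hrec⟩ := CostSampling.exists_recovery_event hs0 (by linarith) hε0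
      (lt_of_lt_of_le (Nat.pos_of_ne_zero hn0) hnm) hvm
      ((MeasureTheory.withDensity_absolutelyContinuous _ _).ae_le hvv') hK hbad hf hfn.1
    refine ⟨E, hE, hEm, fun x hx e => ?_⟩
    obtain ⟨hw, hbound⟩ := hrec x hx
    refine ⟨CostSampling.exists_isWLSMinimizer _ hw _, fun fhat hfhat => ?_⟩
    have hb := hbound e fhat hfhat
    have hfnc := CostSampling.continuous_of_mem_polySpace hfn.1
    have hfhc := CostSampling.continuous_of_mem_polySpace hfhat.1
    have hgt : eLpNorm (f - fn) 2 CostSampling.unif ≠ ∞ :=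
      (hf.sub (CostSampling.memLp_of_mem_polySpace hfn.1 2)).2.ne
    -- The uniform bound on `fhat - fn` controls every `L^q` norm with the same constant because
    -- `unif` has mass one; this covers `q = 2` and `q = ∞` at once.
    have key : ∀ q : ℝ≥0∞, 1 ≤ q → eLpNorm (f - fhat) q CostSampling.unif ≤
        eLpNorm (f - fn) q CostSampling.unif + ENNReal.ofReal (8 * r * n / Real.sqrt ε) *
          (eLpNorm (f - fn) 2 CostSampling.unif + ‖e‖ₑ) := by
      intro q hq
      have h1 : f - fhat = (f - fn) - (fhat - fn) := by abel
      rw [h1]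
      refine (eLpNorm_sub_le (hf.1.sub hfnc.aestronglyMeasurable)
        (hfhc.sub hfnc).aestronglyMeasurable hq).trans ?_
      gcongr
      refine (eLpNorm_le_of_ae_bound (C := 8 * r * n / Real.sqrt ε *
        ((eLpNorm (f - fn) 2 CostSampling.unif).toReal + ‖e‖)) ?_).trans (le_of_eq ?_)
      · refine Measure.ae_smul_measure ?_ _
        filter_upwards [ae_restrict_mem measurableSet_Ioo] with t ht
        exact hb t (abs_le.2 ⟨ht.1.le, ht.2.le⟩)
      · rw [measure_univ, ENNReal.one_rpow, one_mul, ENNReal.ofReal_mul (by positivity),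
          ENNReal.ofReal_add ENNReal.toReal_nonneg (norm_nonneg _), ENNReal.ofReal_toReal hgt,
          ofReal_norm]
    exact ⟨key 2 one_le_two, key ∞ le_top⟩
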